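/- **Setting.** Fix a number of rounds $K\ge 1$ and a dimension $d\ge 1$. In round $k=1,\dots,K$ an arm set $\mathcal D_k\subseteq\mathbb R^d$ (possibly random) is revealed, the learner picks $a_k\in\mathcal D_k$ and observes the reward $r_k=\langle\theta_k,a_k\rangle+\epsilon_k$ together with $\sigma_k\ge 0$. The unknown vectors $\theta_1,\dots,\theta_K\in\mathbb R^d$ are deterministic. Almost surely $|\epsilon_k|\le R$, $\mathbb E[\epsilon_k\mid a_{1:k},\epsilon_{1:k-1}]=0$ and $\mathbb E[\epsilon_k^2\mid a_{1:k},\epsilon_{1:k-1}]=\sigma_k^2$. Moreover $\|\theta_k\|_2\le B$, $\|a\|_2\le A$ and $\langle a,\theta_k\rangle\in[-1,1]$ for all $k$ and all $a\in\mathcal D_k$, and $$\sum_{k=1}^{K-1}\|\theta_{k+1}-\theta_k\|_2\le B_K,\qquad \sum_{k=1}^{K}\sigma_k^2\le V_K .$$ The dynamic regret is $\mathrm{Regret}(K)=\sum_{k=1}^K(\langle a_k^*,\theta_k\rangle-\langle a_k,\theta_k\rangle)$, where $a_k^*\in\arg\max_{a\in\mathcal D_k}\langle a,\theta_k\rangle$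 (the maxima here and in the algorithm are assumed to be attained). **Algorithm (Restarted-WeightedOFUL$^+$)** with parameters $\lambda,\alpha,\gamma>0$, integer window size $n\ge1$ and $\delta\in(0,1)$. In round $1$ and in every round $k$ divisible by $n$, set $\hat\Sigma_k=\lambda I$, $\hat b_k=0$, $\hat\beta_k=\sqrt\lambda B$. In every other round, with $m=k\bmod n$ and $\ell_m=\log\big(32(\log^+(\gamma^2/\alpha)+1)m^2/\delta\big)$, where $\log^+x=\max\{0,\log x\}$, $$\hat\beta_k=12\sqrt{d\log\Big(1+\frac{mA^2}{\alpha^2d\lambda}\Big)\ell_m}+30\,\ell_m\frac{R}{\gamma^2}+\sqrt\lambda B .$$ With $\hat\theta_k=\hat\Sigma_k^{-1}\hat b_k$ and $\|a\|_M=\sqrt{a^\top M a}$, choose $a_k\in\arg\max_{a\in\mathcal D_k}\langle a,\hat\theta_k\rangle+\hat\beta_k\|a\|_{\hat\Sigma_k^{-1}}$, set $\bar\sigma_k=\max\{\sigma_k,\alpha,\gamma\|a_k\|_{\hat\Sigma_k^{-1}}^{1/2}\}$, and (unless round $k+1$ is a restart) $\hat\Sigma_{k+1}=\hat\Sigma_k+a_ka_k^\top/\bar\sigma_k^2$,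 $\hat b_{k+1}=\hat b_k+r_ka_k/\bar\sigma_k^2$. **Statement.** There is an absolute constant $p\in\mathbb N$ such that for all constants $A,B,R,\lambda,c_1,c_2>0$ there is a constant $C>0$, depending only on these, such that the following holds for all $d,K\ge1$, all $\delta\in(0,1)$, all $B_K,V_K\in[c_1,c_2K]$ and every environment as above. Let $$w=\begin{cases}d^{1/4}\sqrt{V_K/B_K}, & dV_K^6\ge K^4B_K^2,\\ d^{1/6}(K/B_K)^{1/3}, &\text{otherwise,}\end{cases}\qquad \alpha=d^{-1/4}B_K^{1/2}wK^{-1/2},\qquad \gamma^2=R/\sqrt d .$$ Run Restarted-WeightedOFUL$^+$ with these parameters, the window size being any integer $n\ge1$ with $|n-w|<1$ (that is, $w$ rounded down or up). Then with probability at least $1-\delta$, $$\mathrm{Regret}(K)\le C\,\Big(1+\log\frac{dK}{\delta}\Big)^{p}\Big(d^{7/8}(B_KV_K)^{1/4}\sqrt K+d^{5/6}B_K^{1/3}K^{2/3}\Big).$$ -/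

import Mathlib

open MeasureTheory
open scoped Matrix

noncomputable section

namespace NonstatBandit

/-- Vectors of `ℝ^d` with the Euclidean norm. -/
abbrev Vec (d : ℕ) := EuclideanSpace ℝ (Fin d)

/-- The weighted norm `‖x‖_M = √(xᵀ M x)`. -/
def matNorm {d : ℕ} (M : Matrix (Fin d) (Fin d) ℝ) (x : Vec d) : ℝ :=
  Real.sqrt (x.ofLp ⬝ᵥ (M *ᵥ x.ofLp))

/-! ### The algorithm -/

/-- Inputs of the algorithm: regularization `lam`, bound `B` on the norms of the feature vectors,
variance parameters `α`, `γ`, restart window size `w`, noise bound `R`, arm bound `A`, and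
confidence level `δ` (the last three enter through the confidence radius only). -/
structure Params where
  lam : ℝ
  B : ℝ
  α : ℝ
  γ : ℝ
  w : ℕ
  R : ℝ
  A : ℝ
  δ : ℝ

/-- The statistics `Σ̂`, `b̂` kept by the algorithm. -/
structure Stats (d : ℕ) where
  cov : Matrix (Fin d) (Fin d) ℝ
  b : Vec d

/-- Fresh statistics: `Σ̂ = λ I`, `b̂ = 0`. -/
def Stats.init (d : ℕ) (P : Params) : Stats d where
  cov := P.lam • (1 : Matrix (Fin d) (Fin d) ℝ)
  b := 0

/-- The estimate `θ̂ = Σ̂⁻¹ b̂`. -/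
def Stats.estimate {d : ℕ} (S : Stats d) : Vec d :=
  WithLp.toLp 2 (S.cov⁻¹ *ᵥ S.b.ofLp)

/-- `σ̄ = max {σ, α, γ ‖a‖_{Σ̂⁻¹}^{1/2}}`. -/
def Stats.sigmaBar {d : ℕ} (P : Params) (S : Stats d) (a : Vec d) (σ : ℝ) : ℝ :=
  max σ (max P.α (P.γ * Real.sqrt (matNorm S.cov⁻¹ a)))

/-- One weighted regression update with the arm `a`, the reward `r` and the standard
deviation `σ`. -/
def Stats.update {d : ℕ} (P : Params) (S : Stats d) (a : Vec d) (r σ : ℝ) : Stats d where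
  cov := S.cov + (1 / S.sigmaBar P a σ ^ 2) • Matrix.vecMulVec a.ofLp a.ofLp
  b := S.b + (r / S.sigmaBar P a σ ^ 2) • a

/-- The statistics with which the algorithm chooses its arm in round `k` (rounds are numbered
`1, 2, …`; the value at `0` is a placeholder), given the arms, rewards and standard deviations of
the rounds `1, …, k - 1`. They are fresh in round `1` and in the rounds divisible by `w`. -/
def stats {d : ℕ} (P : Params) (a : ℕ → Vec d) (r σ : ℕ → ℝ) : ℕ → Stats d
  | 0 => Stats.init d P
  | k + 1 =>
      if k = 0 ∨ (k + 1) % P.w = 0 then Stats.init d P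
      else (stats P a r σ k).update P (a k) (r k) (σ k)

/-- The logarithmic factor `log (32 (log⁺ (γ² / α) + 1) m² / δ)`. -/
def logFactor (P : Params) (m : ℕ) : ℝ :=
  Real.log (32 * (Real.posLog (P.γ ^ 2 / P.α) + 1) * (m : ℝ) ^ 2 / P.δ)

/-- The confidence radius `β̂_k`. -/
def radius (d : ℕ) (P : Params) (k : ℕ) : ℝ :=
  if k = 1 ∨ k % P.w = 0 then Real.sqrt P.lam * P.B
  else
    12 * Real.sqrt
        (d * Real.log (1 + ((k % P.w : ℕ) : ℝ) * P.A ^ 2 / (P.α ^ 2 * d * P.lam))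
          * logFactor P (k % P.w))
      + 30 * logFactor P (k % P.w) * (P.R / P.γ ^ 2)
      + Real.sqrt P.lam * P.B

/-- The upper confidence bound `⟨x, θ̂_k⟩ + β̂_k ‖x‖_{Σ̂_k⁻¹}` of an arm `x`, computed from the
statistics `S` of round `k`. -/
def ucb {d : ℕ} (P : Params) (S : Stats d) (k : ℕ) (x : Vec d) : ℝ :=
  inner ℝ x S.estimate + radius d P k * matNorm S.cov⁻¹ x

/-- In each of the rounds `1, …, K` the arm `a k` is one that Restarted-WeightedOFUL⁺ may choose
from the arm set `D k`: it maximizes the upper confidence bound. -/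
def IsRun {d : ℕ} (P : Params) (K : ℕ) (D : ℕ → Set (Vec d)) (a : ℕ → Vec d)
    (r σ : ℕ → ℝ) : Prop :=
  ∀ k ∈ Finset.Icc 1 K, a k ∈ D k ∧ IsMaxOn (ucb P (stats P a r σ k) k) (D k) (a k)

/-! ### The environment -/

/-- The `σ`-algebra generated by `a_1, …, a_k` and `ε_1, …, ε_{k-1}`. -/
abbrev history {Ω : Type*} {d : ℕ} (a : ℕ → Ω → Vec d) (ε : ℕ → Ω → ℝ) (k : ℕ) :
    MeasurableSpace Ω :=
  (⨆ t ∈ Set.Icc 1 k, MeasurableSpace.comap (a t) inferInstance) ⊔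
    (⨆ t ∈ Set.Ico 1 k, MeasurableSpace.comap (ε t) inferInstance)

/-- The heteroscedastic non-stationary linear bandit over `K` rounds, with (possibly random) arm
sets `D`, deterministic feature vectors `θ` (oblivious adversary), chosen arms `a`, noises `ε` and
conditional standard deviations `σ`. -/
structure IsBandit {Ω : Type*} [MeasurableSpace Ω] (μ : Measure Ω) {d : ℕ} (K : ℕ)
    (A B R BK VK : ℝ) (D : ℕ → Ω → Set (Vec d)) (θ : ℕ → Vec d) (a : ℕ → Ω → Vec d)
    (ε σ : ℕ → Ω → ℝ) : Prop where
  measurable_arm : ∀ k ∈ Finset.Icc 1 K, Measurable (a k)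
  measurable_noise : ∀ k ∈ Finset.Icc 1 K, Measurable (ε k)
  norm_arm_le : ∀ k ∈ Finset.Icc 1 K, ∀ ω, ∀ x ∈ D k ω, ‖x‖ ≤ A
  mean_reward_mem : ∀ k ∈ Finset.Icc 1 K, ∀ ω, ∀ x ∈ D k ω, inner ℝ x (θ k) ∈ Set.Icc (-1 : ℝ) 1
  norm_feature_le : ∀ k ∈ Finset.Icc 1 K, ‖θ k‖ ≤ B
  noise_bounded : ∀ k ∈ Finset.Icc 1 K, ∀ᵐ ω ∂μ, |ε k ω| ≤ R
  noise_mean : ∀ k ∈ Finset.Icc 1 K, μ[ε k | history a ε k] =ᵐ[μ] 0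
  sd_nonneg : ∀ k ∈ Finset.Icc 1 K, ∀ ω, 0 ≤ σ k ω
  noise_variance : ∀ k ∈ Finset.Icc 1 K,
    μ[fun ω => ε k ω ^ 2 | history a ε k] =ᵐ[μ] fun ω => σ k ω ^ 2
  total_variation : ∑ k ∈ Finset.Ico 1 K, ‖θ (k + 1) - θ k‖ ≤ BK
  total_variance : ∀ᵐ ω ∂μ, ∑ k ∈ Finset.Icc 1 K, σ k ω ^ 2 ≤ VK

/-- The reward `r_k = ⟨θ_k, a_k⟩ + ε_k`. -/
def reward {d : ℕ} (θ a : ℕ → Vec d) (ε : ℕ → ℝ) (k : ℕ) : ℝ :=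
  inner ℝ (θ k) (a k) + ε k

/-- The dynamic regret `∑_k (⟨a*_k, θ_k⟩ - ⟨a_k, θ_k⟩)`. -/
def regret {d : ℕ} (K : ℕ) (θ aStar a : ℕ → Vec d) : ℝ :=
  ∑ k ∈ Finset.Icc 1 K, (inner ℝ (aStar k) (θ k) - inner ℝ (a k) (θ k))

/-! ### The choice of parameters -/

/-- The (real) target for the restart window size. -/
def targetWindow (d K : ℕ) (BK VK : ℝ) : ℝ :=
  if (K : ℝ) ^ 4 * BK ^ 2 ≤ d * VK ^ 6 then (d : ℝ) ^ (1 / 4 : ℝ) * Real.sqrt (VK / BK)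
  else (d : ℝ) ^ (1 / 6 : ℝ) * (K / BK) ^ (1 / 3 : ℝ)

/-- The tuned parameters, `n` being the integer restart window size:
`α = d^{-1/4} B_K^{1/2} w K^{-1/2}` and `γ² = R / √d`. -/
def tunedParams (d K n : ℕ) (A B R lam δ BK VK : ℝ) : Params where
  lam := lam
  B := B
  α := (d : ℝ) ^ (-(1 / 4) : ℝ) * BK ^ (1 / 2 : ℝ) * targetWindow d K BK VK
    * (K : ℝ) ^ (-(1 / 2) : ℝ)
  γ := Real.sqrt (R / Real.sqrt d)
  w := n
  R := R
  A := A
  δ := δ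

end NonstatBandit

end

noncomputable section

namespace NonstatBandit

/-! Within a window the reward splits, relative to the current vector `θ k`, into noise, a drift
term `⟨θ t - θ k, a t⟩` and a stationary part that regression recovers up to the bias `λ θ k`. By
Cauchy–Schwarz the estimation error in a direction `x` is at most `‖x‖_{Σ̂⁻¹}` times the sum of the
`Σ̂⁻¹`-norms of the noise part of `b̂`, of its drift part, and `√λ B` (`abs_estimate_error_le`). The
drift is bounded deterministically through the floor `α` on the weights; if the noise norm fits in
the confidence radius, optimism bounds the instantaneous regret (`instant_regret_le`). Summing, with
`log det` telescoping inside each window, gives `regret_le_of_card_isBad`.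

The noise is controlled by a supermartingale of the form `exp (s √(ρ² + ‖b̂‖²) - κ log det)`. One
update changes the square root by a term linear in the noise, whose conditional mean vanishes, and a
quadratic one, whose conditional expectation is paid for by the growth of `log det`. The floor `γ
‖a‖^{1/2}` keeps each increment below a multiple of `R / γ²`, which makes the second-order expansion
of `exp` legitimate. Markov's inequality then gives a Bernstein bound at each fixed round
(`IsBandit.measureReal_potential_gt_le`); no maximal inequality is needed.

The radius only budgets a failure probability of order `δ / m²` for position `m` in a window, so a
union bound over all windows would fail. Instead the expected number of bad rounds is at most `δ`
times the bound `K / n + 1` on the number of windows. By Markov, with probability at least `1 - δ`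
there are at most that many bad rounds (`IsBandit.measureReal_card_isBad_gt_le`). Each costs at most
2, so together they cost no more than the restarts are charged.

It remains to insert the parameters. Up to logarithms there are `K / w` windows, `log det ≲ d` and
the radius is `≲ √d`. The terms are then `dK/w`, `d √(K V_K / w)`, `dKα/√w` and `w^{3/2} B_K / α`,
all compared with the rate in `tuned_rates`. If `w > K`, the trivial bound `2K` is already of the
order of the rate. -/

/-- The bilinear form `x ᵀ Z⁻¹ y`. -/
def invForm {d : ℕ} (Z : Matrix (Fin d) (Fin d) ℝ) (x y : Fin d → ℝ) : ℝ := x ⬝ᵥ (Z⁻¹ *ᵥ y)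

/-! ### Rank-one updates of positive definite matrices -/

section LinearAlgebra

variable {d : ℕ} {Z : Matrix (Fin d) (Fin d) ℝ}

lemma invForm_add_right (x y z : Fin d → ℝ) :
    invForm Z x (y + z) = invForm Z x y + invForm Z x z := by
  simp [invForm, Matrix.mulVec_add, dotProduct_add]

lemma invForm_smul_right (c : ℝ) (x y : Fin d → ℝ) :
    invForm Z x (c • y) = c * invForm Z x y := by
  simp [invForm, Matrix.mulVec_smul]

lemma invForm_comm (hZ : Z.PosDef) (x y : Fin d → ℝ) : invForm Z x y = invForm Z y x := by
  have h : (Z⁻¹)ᵀ = Z⁻¹ := by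
    have := hZ.inv.isHermitian.eq
    rwa [Matrix.conjTranspose_eq_transpose_of_trivial] at this
  unfold invForm
  rw [Matrix.dotProduct_mulVec, ← Matrix.mulVec_transpose, h, dotProduct_comm]

lemma invForm_self_nonneg (hZ : Z.PosDef) (x : Fin d → ℝ) : 0 ≤ invForm Z x x := by
  simpa [invForm] using hZ.inv.posSemidef.dotProduct_mulVec_nonneg x

/-- Cauchy–Schwarz: the quadratic polynomial giving the squared norm of `x + t y` is nonnegative in
`t`, so its discriminant is not positive. -/
lemma invForm_sq_le (hZ : Z.PosDef) (x y : Fin d → ℝ) :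
    invForm Z x y ^ 2 ≤ invForm Z x x * invForm Z y y := by
  have key : ∀ t : ℝ, 0 ≤ invForm Z y y * (t * t) + 2 * invForm Z x y * t + invForm Z x x := by
    intro t
    have h := invForm_self_nonneg hZ (x + t • y)
    have h2 : invForm Z (x + t • y) (x + t • y)
        = invForm Z y y * (t * t) + 2 * invForm Z x y * t + invForm Z x x := by
      rw [invForm_add_right, invForm_smul_right, invForm_comm hZ _ x, invForm_comm hZ _ y,
        invForm_add_right, invForm_add_right, invForm_smul_right, invForm_smul_right,
        invForm_comm hZ y x]
      ring
    rwa [h2] at h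
  have h := discrim_le_zero key
  unfold discrim at h
  nlinarith

lemma posDef_add_rankOne (hZ : Z.PosDef) {c : ℝ} (hc : 0 ≤ c) (a : Fin d → ℝ) :
    (Z + c • Matrix.vecMulVec a a).PosDef := by
  refine hZ.add_posSemidef (Matrix.PosSemidef.smul ?_ hc)
  simpa using Matrix.posSemidef_vecMulVec_self_star a

lemma isUnit_det (hZ : Z.PosDef) : IsUnit Z.det := (Matrix.isUnit_iff_isUnit_det _).1 hZ.isUnit

/-- The Sherman–Morrison formula, verified by multiplying out. -/
lemma inv_add_rankOne (hZ : Z.PosDef) {c : ℝ} (hc : 0 ≤ c) (a : Fin d → ℝ) :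
    (Z + c • Matrix.vecMulVec a a)⁻¹
      = Z⁻¹ - (c / (1 + c * invForm Z a a)) • Matrix.vecMulVec (Z⁻¹ *ᵥ a) (Z⁻¹ *ᵥ a) := by
  have h : (Z⁻¹)ᵀ = Z⁻¹ := by
    have := hZ.inv.isHermitian.eq
    rwa [Matrix.conjTranspose_eq_transpose_of_trivial] at this
  have hpos : 0 < 1 + c * invForm Z a a := by
    have := mul_nonneg hc (invForm_self_nonneg hZ a); linarith
  apply Matrix.inv_eq_right_inv
  have h1 : Z * Matrix.vecMulVec (Z⁻¹ *ᵥ a) (Z⁻¹ *ᵥ a) = Matrix.vecMulVec a (Z⁻¹ *ᵥ a) := by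
    rw [Matrix.mul_vecMulVec, Matrix.mulVec_mulVec, Matrix.mul_nonsing_inv _ (isUnit_det hZ),
      Matrix.one_mulVec]
  have h2 : Matrix.vecMulVec a a * Z⁻¹ = Matrix.vecMulVec a (Z⁻¹ *ᵥ a) := by
    rw [Matrix.vecMulVec_mul, ← Matrix.mulVec_transpose, h]
  have h3 : Matrix.vecMulVec a a * Matrix.vecMulVec (Z⁻¹ *ᵥ a) (Z⁻¹ *ᵥ a)
      = invForm Z a a • Matrix.vecMulVec a (Z⁻¹ *ᵥ a) := by
    rw [Matrix.vecMulVec_mul_vecMulVec]; rw [Matrix.vecMulVec_smul]; rfl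
  rw [add_mul, mul_sub, mul_sub, Matrix.mul_nonsing_inv _ (isUnit_det hZ), Matrix.mul_smul, h1,
    Matrix.smul_mul, h2, Matrix.smul_mul, Matrix.mul_smul, h3]
  have : c - c / (1 + c * invForm Z a a) - c * (c / (1 + c * invForm Z a a) * invForm Z a a)
      = 0 := by
    field_simp; ring
  rw [smul_smul, smul_smul]
  ext i j
  simp only [Matrix.add_apply, Matrix.sub_apply, Matrix.smul_apply, smul_eq_mul]
  linear_combination (Matrix.vecMulVec a (Z⁻¹ *ᵥ a) i j) * this

lemma invForm_add_rankOne (hZ : Z.PosDef) {c : ℝ} (hc : 0 ≤ c) (a x y : Fin d → ℝ) :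
    invForm (Z + c • Matrix.vecMulVec a a) x y
      = invForm Z x y - c * invForm Z x a * invForm Z a y / (1 + c * invForm Z a a) := by
  have e : (Z⁻¹ *ᵥ a) ⬝ᵥ y = invForm Z a y := by
    rw [invForm_comm hZ a y, invForm, dotProduct_comm]
  have e2 : x ⬝ᵥ (Z⁻¹ *ᵥ a) = invForm Z x a := rfl
  rw [invForm, inv_add_rankOne hZ hc, Matrix.sub_mulVec, Matrix.smul_mulVec,
    Matrix.vecMulVec_mulVec, dotProduct_sub, e]
  simp only [dotProduct_smul, op_smul_eq_smul, smul_eq_mul, e2]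
  have e3 : x ⬝ᵥ (Z⁻¹ *ᵥ y) = invForm Z x y := rfl
  rw [e3]
  ring

lemma det_add_rankOne (hZ : Z.PosDef) (c : ℝ) (a : Fin d → ℝ) :
    (Z + c • Matrix.vecMulVec a a).det = Z.det * (1 + c * invForm Z a a) := by
  rw [← Matrix.smul_vecMulVec, Matrix.vecMulVec_eq Unit,
    Matrix.det_add_replicateCol_mul_replicateRow (isUnit_det hZ)]
  congr 1
  rw [Matrix.det_unique, Matrix.add_apply, Matrix.one_apply_eq, Matrix.mul_assoc,
    Matrix.mul_apply]
  congr 1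
  simp only [Matrix.replicateRow_apply, invForm, dotProduct, Finset.mul_sum]
  refine Finset.sum_congr rfl fun i _ => ?_
  rw [Matrix.mul_apply, Matrix.mulVec, dotProduct, Finset.mul_sum, Finset.mul_sum, Finset.mul_sum]
  refine Finset.sum_congr rfl fun j _ => ?_
  simp
  ring

/-- `Z ≥ λ I` implies `Z⁻¹ ≤ λ⁻¹ I`. -/
lemma invForm_self_le (hZ : Z.PosDef) {lam : ℝ} (hl : 0 < lam)
    (h : (Z - lam • (1 : Matrix (Fin d) (Fin d) ℝ)).PosSemidef) (x : Fin d → ℝ) :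
    invForm Z x x ≤ x ⬝ᵥ x / lam := by
  set u := Z⁻¹ *ᵥ x with hu
  have hZu : Z *ᵥ u = x := by
    rw [hu, Matrix.mulVec_mulVec, Matrix.mul_nonsing_inv _ (isUnit_det hZ), Matrix.one_mulVec]
  have h1 : 0 ≤ u ⬝ᵥ x - lam * (u ⬝ᵥ u) := by
    have := h.dotProduct_mulVec_nonneg u
    rw [Matrix.sub_mulVec, dotProduct_sub, hZu, Matrix.smul_mulVec, Matrix.one_mulVec] at this
    simpa using this
  -- Expanding this square and inserting `λ ‖u‖² ≤ u·x` leaves `λ (u·x) ≤ ‖x‖²`; no spectral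
  -- decomposition is needed.
  have h2 : 0 ≤ (x - lam • u) ⬝ᵥ (x - lam • u) := by
    simpa using dotProduct_star_self_nonneg (x - lam • u)
  have h3 : (x - lam • u) ⬝ᵥ (x - lam • u)
      = x ⬝ᵥ x - 2 * lam * (u ⬝ᵥ x) + lam ^ 2 * (u ⬝ᵥ u) := by
    simp only [sub_dotProduct, dotProduct_sub, smul_dotProduct, dotProduct_smul, smul_eq_mul]
    rw [dotProduct_comm x u]; ring
  have h4 : invForm Z x x = u ⬝ᵥ x := by rw [invForm, ← hu, dotProduct_comm]
  rw [h4, le_div_iff₀ hl]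
  rw [h3] at h2
  nlinarith

/-- The inequality between the determinant and the trace of a positive semidefinite matrix. -/
lemma det_le_trace_div_pow (hd : 1 ≤ d) (hZ : Z.PosSemidef) : Z.det ≤ (Z.trace / d) ^ d := by
  have hd0 : (0 : ℝ) < d := by exact_mod_cast hd
  have h0 : ∀ i, 0 ≤ hZ.isHermitian.eigenvalues i := fun i => hZ.eigenvalues_nonneg i
  have amgm := Real.geom_mean_le_arith_mean (s := Finset.univ) (fun _ : Fin d => (1 : ℝ))
    hZ.isHermitian.eigenvalues (fun _ _ => zero_le_one) (by simpa using hd0) (fun i _ => h0 i)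
  simp only [Real.rpow_one, one_mul, Finset.sum_const, Finset.card_univ, Fintype.card_fin,
    nsmul_eq_mul, mul_one] at amgm
  have hp : 0 ≤ ∏ i, hZ.isHermitian.eigenvalues i := Finset.prod_nonneg fun i _ => h0 i
  have e1 : Z.det = ∏ i, hZ.isHermitian.eigenvalues i := by
    simpa using hZ.isHermitian.det_eq_prod_eigenvalues
  have e2 : Z.trace = ∑ i, hZ.isHermitian.eigenvalues i := by
    simpa using hZ.isHermitian.trace_eq_sum_eigenvalues
  rw [e1, e2]
  calc ∏ i, hZ.isHermitian.eigenvalues i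
      = ((∏ i, hZ.isHermitian.eigenvalues i) ^ ((d : ℝ)⁻¹)) ^ d := by
        rw [← Real.rpow_natCast, ← Real.rpow_mul hp, inv_mul_cancel₀ hd0.ne', Real.rpow_one]
    _ ≤ _ := by gcongr

end LinearAlgebra

/-! ### The regression statistics: restarts, linearity in the rewards, determinant and potential -/

section Statistics

variable {d : ℕ}

lemma inner_eq_dotProduct (x y : Vec d) : inner ℝ x y = x.ofLp ⬝ᵥ y.ofLp := by
  rw [EuclideanSpace.inner_eq_star_dotProduct, dotProduct_comm]; simp

lemma matNorm_inv (Z : Matrix (Fin d) (Fin d) ℝ) (x : Vec d) :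
    matNorm Z⁻¹ x = Real.sqrt (invForm Z x.ofLp x.ofLp) := rfl

lemma matNorm_nonneg (Z : Matrix (Fin d) (Fin d) ℝ) (x : Vec d) : 0 ≤ matNorm Z x :=
  Real.sqrt_nonneg _

lemma abs_invForm_le {Z : Matrix (Fin d) (Fin d) ℝ} (hZ : Z.PosDef) (x y : Vec d) :
    |invForm Z x.ofLp y.ofLp| ≤ matNorm Z⁻¹ x * matNorm Z⁻¹ y := by
  rw [matNorm_inv, matNorm_inv, ← Real.sqrt_mul (invForm_self_nonneg hZ _)]
  exact Real.abs_le_sqrt (invForm_sq_le hZ _ _)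

lemma matNorm_inv_le {Z : Matrix (Fin d) (Fin d) ℝ} (hZ : Z.PosDef) {lam : ℝ} (hl : 0 < lam)
    (h : (Z - lam • (1 : Matrix (Fin d) (Fin d) ℝ)).PosSemidef) (x : Vec d) :
    matNorm Z⁻¹ x ≤ ‖x‖ / Real.sqrt lam := by
  rw [matNorm_inv]
  apply Real.sqrt_le_iff.2 ⟨by positivity, ?_⟩
  rw [div_pow, Real.sq_sqrt hl.le, ← real_inner_self_eq_norm_sq, inner_eq_dotProduct]
  exact invForm_self_le hZ hl h _

/-- The statistics satisfy `Σ̂ ≥ λ I > 0`. -/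
structure Stats.Regular (P : Params) (S : Stats d) : Prop where
  posDef : S.cov.PosDef
  posSemidef : (S.cov - P.lam • (1 : Matrix (Fin d) (Fin d) ℝ)).PosSemidef

lemma Stats.Regular.init {P : Params} (hl : 0 < P.lam) : (Stats.init d P).Regular P := by
  constructor
  · exact Matrix.PosDef.one.smul hl
  · simpa [Stats.init] using Matrix.PosSemidef.zero

lemma Stats.Regular.update {P : Params} {S : Stats d} (hS : S.Regular P) (a : Vec d) (r σ : ℝ) :
    (S.update P a r σ).Regular P := by
  have hc : 0 ≤ 1 / S.sigmaBar P a σ ^ 2 := by positivity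
  constructor
  · exact posDef_add_rankOne hS.posDef hc _
  · have : (S.update P a r σ).cov - P.lam • (1 : Matrix (Fin d) (Fin d) ℝ)
        = (S.cov - P.lam • (1 : Matrix (Fin d) (Fin d) ℝ))
          + (1 / S.sigmaBar P a σ ^ 2) • Matrix.vecMulVec a.ofLp a.ofLp := by
      simp only [Stats.update]; abel
    rw [this]
    refine hS.posSemidef.add (Matrix.PosSemidef.smul ?_ hc)
    simpa using Matrix.posSemidef_vecMulVec_self_star a.ofLp

/-- The rounds in which the statistics are fresh. -/
def Params.IsRestart (P : Params) (k : ℕ) : Prop := k = 1 ∨ k % P.w = 0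

lemma stats_restart (P : Params) (a : ℕ → Vec d) (r σ : ℕ → ℝ) {k : ℕ} (h : P.IsRestart (k + 1)) :
    stats P a r σ (k + 1) = Stats.init d P := by
  rw [stats, if_pos]
  simpa [Params.IsRestart] using h

lemma stats_update (P : Params) (a : ℕ → Vec d) (r σ : ℕ → ℝ) {k : ℕ}
    (h : ¬ P.IsRestart (k + 1)) :
    stats P a r σ (k + 1) = (stats P a r σ k).update P (a k) (r k) (σ k) := by
  rw [stats, if_neg]
  simpa [Params.IsRestart] using h

lemma Params.IsRestart.one (P : Params) : P.IsRestart 1 := Or.inl rfl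

lemma Params.ne_zero_of_not_isRestart {P : Params} {k : ℕ} (h : ¬ P.IsRestart (k + 1)) : k ≠ 0 := by
  rintro rfl; exact h (Params.IsRestart.one P)

/-- `k % w` is the clock of the current window. In the first window it starts from round 1 and
exceeds the number of updates by one, which only weakens the upper bounds that use it. -/
lemma Params.mod_succ {P : Params} {k : ℕ} (h : ¬ P.IsRestart (k + 1)) :
    (k + 1) % P.w = k % P.w + 1 := by
  have h2 : (k + 1) % P.w ≠ 0 := fun h' => h (Or.inr h')
  rcases Nat.eq_zero_or_pos P.w with h0 | h0
  · simp [h0]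
  · rw [Nat.add_mod] at h2 ⊢
    rcases Nat.lt_or_ge 1 P.w with h1 | h1
    · rw [Nat.mod_eq_of_lt h1] at h2 ⊢
      have hk := Nat.mod_lt k h0
      rcases Nat.lt_or_ge (k % P.w + 1) P.w with h3 | h3
      · exact Nat.mod_eq_of_lt h3
      · have : k % P.w + 1 = P.w := by omega
        rw [this, Nat.mod_self] at h2
        exact absurd rfl h2
    · have : P.w = 1 := by omega
      simp [this, Nat.mod_one] at h2

lemma stats_regular {P : Params} (hl : 0 < P.lam) (a : ℕ → Vec d) (r σ : ℕ → ℝ) (k : ℕ) :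
    (stats P a r σ k).Regular P := by
  induction k with
  | zero => exact Stats.Regular.init hl
  | succ k ih =>
    by_cases h : P.IsRestart (k + 1)
    · rw [stats_restart P a r σ h]; exact Stats.Regular.init hl
    · rw [stats_update P a r σ h]; exact ih.update _ _ _

/-- Neither `Σ̂` nor the weights depend on the rewards. Hence `b̂` is linear in them, and noise,
drift and signal can be run through the same recursion separately. -/
lemma stats_cov_congr (P : Params) (a : ℕ → Vec d) (r r' σ : ℕ → ℝ) (k : ℕ) :
    (stats P a r σ k).cov = (stats P a r' σ k).cov := by
  induction k with
  | zero => rfl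
  | succ k ih =>
    by_cases h : P.IsRestart (k + 1)
    · rw [stats_restart P a r σ h, stats_restart P a r' σ h]
    · rw [stats_update P a r σ h, stats_update P a r' σ h]
      simp [Stats.update, Stats.sigmaBar, ih]

lemma stats_b_add (P : Params) (a : ℕ → Vec d) (r r' σ : ℕ → ℝ) (k : ℕ) :
    (stats P a (fun t => r t + r' t) σ k).b = (stats P a r σ k).b + (stats P a r' σ k).b := by
  induction k with
  | zero => simp [stats, Stats.init]
  | succ k ih =>
    by_cases h : P.IsRestart (k + 1)
    · simp only [stats_restart P a _ σ h]; simp [Stats.init]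
    · simp only [stats_update P a _ σ h]
      simp only [Stats.update, Stats.sigmaBar, ih, stats_cov_congr P a (fun t => r t + r' t) r σ k,
        stats_cov_congr P a r' r σ k, add_div, add_smul]
      abel

/-- For noiseless rewards from a fixed `θ`, each update adds the same rank-one matrix applied to `θ`
to `b̂` as it adds to `Σ̂`; only the regularization is missing. -/
lemma stats_b_inner (P : Params) (a : ℕ → Vec d) (θ : Vec d) (σ : ℕ → ℝ) (k : ℕ) :
    (stats P a (fun t => inner ℝ θ (a t)) σ k).b.ofLp
      = (stats P a (fun t => inner ℝ θ (a t)) σ k).cov *ᵥ θ.ofLp - P.lam • θ.ofLp := by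
  induction k with
  | zero => simp [stats, Stats.init, Matrix.smul_mulVec]
  | succ k ih =>
    by_cases h : P.IsRestart (k + 1)
    · rw [stats_restart P a _ σ h]; simp [Stats.init, Matrix.smul_mulVec]
    · rw [stats_update P a _ σ h]
      simp only [Stats.update, WithLp.ofLp_add, WithLp.ofLp_smul, ih, Matrix.add_mulVec,
        Matrix.smul_mulVec, Matrix.vecMulVec_mulVec]
      rw [inner_eq_dotProduct, dotProduct_comm]
      ext i
      simp only [Pi.add_apply, Pi.sub_apply, Pi.smul_apply, smul_eq_mul, MulOpposite.smul_eq_mul_unop,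
        MulOpposite.unop_op]
      ring

lemma le_sigmaBar (P : Params) (S : Stats d) (a : Vec d) (σ : ℝ) : P.α ≤ S.sigmaBar P a σ :=
  (le_max_left _ _).trans (le_max_right _ _)

lemma sigma_le_sigmaBar (P : Params) (S : Stats d) (a : Vec d) (σ : ℝ) : σ ≤ S.sigmaBar P a σ :=
  le_max_left _ _

lemma gamma_sq_mul_le_sigmaBar_sq {P : Params} (hγ : 0 ≤ P.γ) (S : Stats d) (a : Vec d) (σ : ℝ) :
    P.γ ^ 2 * matNorm S.cov⁻¹ a ≤ S.sigmaBar P a σ ^ 2 := by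
  have h : P.γ * Real.sqrt (matNorm S.cov⁻¹ a) ≤ S.sigmaBar P a σ :=
    (le_max_right _ _).trans (le_max_right _ _)
  calc P.γ ^ 2 * matNorm S.cov⁻¹ a = (P.γ * Real.sqrt (matNorm S.cov⁻¹ a)) ^ 2 := by
        rw [mul_pow, Real.sq_sqrt (matNorm_nonneg _ _)]
    _ ≤ _ := by gcongr

/-- The squared weighted norm `‖a / σ̄‖²_{Σ̂⁻¹}`. -/
def Stats.weight (P : Params) (S : Stats d) (a : Vec d) (σ : ℝ) : ℝ :=
  1 / S.sigmaBar P a σ ^ 2 * invForm S.cov a.ofLp a.ofLp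

/-- `log det (Σ̂ / λ)`. -/
def Stats.logDet (P : Params) (S : Stats d) : ℝ := Real.log (S.cov.det / P.lam ^ d)

/-- The potential `‖b̂‖²_{Σ̂⁻¹}`. -/
def Stats.potential (S : Stats d) : ℝ := invForm S.cov S.b.ofLp S.b.ofLp

lemma Stats.Regular.weight_nonneg {P : Params} {S : Stats d} (hS : S.Regular P) (a : Vec d)
    (σ : ℝ) : 0 ≤ S.weight P a σ :=
  mul_nonneg (by positivity) (invForm_self_nonneg hS.posDef _)

lemma logDet_init {P : Params} (hl : 0 < P.lam) : (Stats.init d P).logDet P = 0 := by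
  have : P.lam ^ d ≠ 0 := (pow_pos hl d).ne'
  simp [Stats.logDet, Stats.init, div_self this]

lemma Stats.Regular.logDet_update {P : Params} {S : Stats d} (hl : 0 < P.lam) (hS : S.Regular P)
    (a : Vec d) (r σ : ℝ) :
    (S.update P a r σ).logDet P = S.logDet P + Real.log (1 + S.weight P a σ) := by
  have hd : (S.update P a r σ).cov.det = S.cov.det * (1 + S.weight P a σ) :=
    det_add_rankOne hS.posDef _ _
  have h1 := hS.posDef.det_pos
  have h2 := hS.weight_nonneg a σ
  have h3 := pow_pos hl d
  rw [Stats.logDet, hd, Stats.logDet, mul_div_right_comm, Real.log_mul (by positivity)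
    (by positivity)]

lemma Stats.Regular.logDet_le {P : Params} {S : Stats d} (hl : 0 < P.lam) (hd : 1 ≤ d)
    (hS : S.Regular P) {T : ℝ} (h : S.cov.trace ≤ d * P.lam + T) :
    S.logDet P ≤ d * Real.log (1 + T / (d * P.lam)) := by
  have hd0 : (0 : ℝ) < d := by exact_mod_cast hd
  have h1 := hS.posDef.det_pos
  have h2 := det_le_trace_div_pow hd hS.posDef.posSemidef
  have h3 : S.cov.trace / d / P.lam ≤ 1 + T / (d * P.lam) := by
    rw [div_div, div_le_iff₀ (by positivity)]
    field_simp; linarith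
  have ht : 0 ≤ S.cov.trace := hS.posDef.posSemidef.trace_nonneg
  rw [Stats.logDet, ← Real.log_pow]
  apply Real.log_le_log (by positivity)
  calc S.cov.det / P.lam ^ d ≤ (S.cov.trace / d) ^ d / P.lam ^ d := by gcongr
    _ = (S.cov.trace / d / P.lam) ^ d := by rw [div_pow _ P.lam]
    _ ≤ _ := by gcongr

lemma trace_init (P : Params) : (Stats.init d P).cov.trace = d * P.lam := by
  simp [Stats.init, Matrix.trace_smul, mul_comm]

lemma trace_update_le {P : Params} (hα : 0 < P.α) (S : Stats d) {a : Vec d} {A : ℝ}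
    (ha : ‖a‖ ≤ A) (r σ : ℝ) :
    (S.update P a r σ).cov.trace ≤ S.cov.trace + A ^ 2 / P.α ^ 2 := by
  have h1 : a.ofLp ⬝ᵥ a.ofLp = ‖a‖ ^ 2 := by
    rw [← inner_eq_dotProduct, real_inner_self_eq_norm_sq]
  have h2 := le_sigmaBar P S a σ
  simp only [Stats.update, Matrix.trace_add, Matrix.trace_smul, Matrix.trace_vecMulVec, h1,
    smul_eq_mul]
  gcongr
  rw [one_div_mul_eq_div]
  gcongr

lemma trace_stats_le {P : Params} (hα : 0 < P.α) {a : ℕ → Vec d} (r σ : ℕ → ℝ) {A : ℝ} {K : ℕ}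
    (ha : ∀ t ∈ Finset.Icc 1 K, ‖a t‖ ≤ A) {k : ℕ} (hk : k ≤ K + 1) :
    (stats P a r σ k).cov.trace ≤ d * P.lam + (k % P.w : ℕ) * (A ^ 2 / P.α ^ 2) := by
  induction k with
  | zero => simp [stats, trace_init]
  | succ k ih =>
    by_cases h : P.IsRestart (k + 1)
    · rw [stats_restart P a r σ h, trace_init]
      have : 0 ≤ (((k + 1) % P.w : ℕ) : ℝ) * (A ^ 2 / P.α ^ 2) := by positivity
      linarith
    · have hk0 := Params.ne_zero_of_not_isRestart h
      rw [stats_update P a r σ h, Params.mod_succ h]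
      have h1 := trace_update_le hα (stats P a r σ k)
        (ha k (Finset.mem_Icc.2 ⟨by omega, by omega⟩)) (r k) (σ k)
      have h2 := ih (by omega)
      push_cast
      linarith

/-- Sherman–Morrison, in the normalized quantities `η = r / σ̄`, `y = ⟨a, b̂⟩_{Σ̂⁻¹} / σ̄` and `W =
‖a / σ̄‖²_{Σ̂⁻¹}`: the increment is `(2ηy + η²W - y²) / (1 + W)`. -/
lemma potential_update {P : Params} (hα : 0 < P.α) {S : Stats d} (hS : S.Regular P) (a : Vec d)
    (r σ : ℝ) :
    (S.update P a r σ).potential = S.potential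
      + (2 * (r / S.sigmaBar P a σ) * (invForm S.cov a.ofLp S.b.ofLp / S.sigmaBar P a σ)
          + (r / S.sigmaBar P a σ) ^ 2 * S.weight P a σ
          - (invForm S.cov a.ofLp S.b.ofLp / S.sigmaBar P a σ) ^ 2) / (1 + S.weight P a σ) := by
  have hs : 0 < S.sigmaBar P a σ := hα.trans_le (le_sigmaBar P S a σ)
  have hw := hS.weight_nonneg a σ
  have e : (S.update P a r σ).potential
      = invForm (S.cov + (1 / S.sigmaBar P a σ ^ 2) • Matrix.vecMulVec a.ofLp a.ofLp)
        (S.b.ofLp + (r / S.sigmaBar P a σ ^ 2) • a.ofLp)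
        (S.b.ofLp + (r / S.sigmaBar P a σ ^ 2) • a.ofLp) := rfl
  rw [e, invForm_add_rankOne hS.posDef (by positivity)]
  have e2 : (1 : ℝ) + 1 / S.sigmaBar P a σ ^ 2 * invForm S.cov a.ofLp a.ofLp
    = 1 + S.weight P a σ := rfl
  rw [e2]
  have hwe : invForm S.cov a.ofLp a.ofLp = S.weight P a σ * S.sigmaBar P a σ ^ 2 := by
    rw [Stats.weight]; field_simp
  rw [invForm_comm hS.posDef _ a.ofLp]
  simp only [invForm_add_right, invForm_smul_right]
  rw [invForm_comm hS.posDef (S.b.ofLp + _) S.b.ofLp, invForm_comm hS.posDef (S.b.ofLp + _) a.ofLp]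
  simp only [invForm_add_right, invForm_smul_right]
  rw [invForm_comm hS.posDef S.b.ofLp a.ofLp, hwe, Stats.potential]
  generalize S.weight P a σ = w at *
  generalize S.sigmaBar P a σ = s at *
  generalize invForm S.cov a.ofLp S.b.ofLp = y
  field_simp
  ring

lemma potential_init (P : Params) : (Stats.init d P).potential = 0 := by
  simp [Stats.potential, Stats.init, invForm]

/-- Since `(η - y)² ≥ 0`, the increment is at most `η²`. This crude bound serves for the drift,
where no cancellation is available. -/
lemma potential_update_le {P : Params} (hα : 0 < P.α) {S : Stats d} (hS : S.Regular P) (a : Vec d)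
    (r σ : ℝ) :
    (S.update P a r σ).potential ≤ S.potential + r ^ 2 / P.α ^ 2 := by
  have hs : 0 < S.sigmaBar P a σ := hα.trans_le (le_sigmaBar P S a σ)
  have hw := hS.weight_nonneg a σ
  rw [potential_update hα hS]
  refine add_le_add le_rfl ?_
  calc _ ≤ (r / S.sigmaBar P a σ) ^ 2 := by
        rw [div_le_iff₀ (by positivity)]
        nlinarith [sq_nonneg
          (r / S.sigmaBar P a σ - invForm S.cov a.ofLp S.b.ofLp / S.sigmaBar P a σ)]
    _ = r ^ 2 / S.sigmaBar P a σ ^ 2 := div_pow _ _ _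
    _ ≤ _ := by
        have := le_sigmaBar P S a σ
        gcongr

lemma potential_stats_le {P : Params} (hl : 0 < P.lam) (hα : 0 < P.α) (a : ℕ → Vec d)
    (r σ : ℕ → ℝ) (k : ℕ) (hk : 1 ≤ k) :
    (stats P a r σ k).potential ≤ ∑ t ∈ Finset.Ico (max 1 (k - k % P.w)) k, r t ^ 2 / P.α ^ 2 := by
  induction k with
  | zero => omega
  | succ k ih =>
    by_cases h : P.IsRestart (k + 1)
    · rw [stats_restart P a r σ h, potential_init]
      exact Finset.sum_nonneg fun t _ => by positivity
    · have hk0 := Params.ne_zero_of_not_isRestart h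
      -- Inside a window `k` and `k % w` advance together, so the left end of the sum stays put.
      rw [stats_update P a r σ h, Params.mod_succ h, Nat.add_sub_add_right,
        Finset.sum_Ico_succ_top (by omega)]
      exact (potential_update_le hα (stats_regular hl a r σ k) _ _ _).trans
        (by gcongr; exact ih (by omega))

end Statistics

/-! ### Deterministic regret bound -/

section Regret

variable {d : ℕ}

lemma inner_estimate (S : Stats d) (x : Vec d) :
    inner ℝ x S.estimate = invForm S.cov x.ofLp S.b.ofLp := by
  rw [inner_eq_dotProduct]; rfl

/-- The reward is written as noise plus drift relative to `θ k` plus a stationary signal; by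
`stats_b_inner` the signal contributes the truth and a regularization bias. -/
lemma estimate_error (P : Params) (hl : 0 < P.lam) (a θ : ℕ → Vec d) (ε σ : ℕ → ℝ) (k : ℕ)
    (x : Vec d) :
    inner ℝ x (stats P a (reward θ a ε) σ k).estimate - inner ℝ x (θ k)
      = invForm (stats P a ε σ k).cov x.ofLp (stats P a ε σ k).b.ofLp
        + invForm (stats P a ε σ k).cov x.ofLp
            (stats P a (fun t => inner ℝ (θ t - θ k) (a t)) σ k).b.ofLp
        - P.lam * invForm (stats P a ε σ k).cov x.ofLp (θ k).ofLp := by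
  have hr : reward θ a ε = fun t => (ε t + inner ℝ (θ t - θ k) (a t)) + inner ℝ (θ k) (a t) := by
    funext t; simp only [reward, inner_sub_left]; ring
  have hS := (stats_regular hl a ε σ k).posDef
  rw [inner_estimate, stats_cov_congr P a _ ε σ k, hr,
    stats_b_add P a (fun t => ε t + inner ℝ (θ t - θ k) (a t)), stats_b_add P a ε,
    WithLp.ofLp_add, WithLp.ofLp_add, stats_b_inner,
    stats_cov_congr P a (fun t => inner ℝ (θ k) (a t)) ε σ k, invForm_add_right, invForm_add_right, sub_eq_add_neg _ (P.lam • _), ← neg_smul,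
    invForm_add_right, invForm_smul_right]
  have : invForm (stats P a ε σ k).cov x.ofLp ((stats P a ε σ k).cov *ᵥ (θ k).ofLp)
      = inner ℝ x (θ k) := by
    rw [invForm, Matrix.mulVec_mulVec, Matrix.nonsing_inv_mul _ (isUnit_det hS), Matrix.one_mulVec,
      inner_eq_dotProduct]
  rw [this]
  ring

lemma abs_estimate_error_le (P : Params) (hl : 0 < P.lam) (a θ : ℕ → Vec d) (ε σ : ℕ → ℝ) (k : ℕ)
    {B : ℝ} (hB : ‖θ k‖ ≤ B) (x : Vec d) :
    |inner ℝ x (stats P a (reward θ a ε) σ k).estimate - inner ℝ x (θ k)|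
      ≤ (Real.sqrt (stats P a ε σ k).potential
        + Real.sqrt (stats P a (fun t => inner ℝ (θ t - θ k) (a t)) σ k).potential
        + Real.sqrt P.lam * B) * matNorm (stats P a ε σ k).cov⁻¹ x := by
  have hS := stats_regular hl a ε σ k
  set r' : ℕ → ℝ := fun t => inner ℝ (θ t - θ k) (a t) with hr'
  have h1 := abs_invForm_le hS.posDef x (stats P a ε σ k).b
  have h2 := abs_invForm_le hS.posDef x (stats P a r' σ k).b
  have h3 := abs_invForm_le hS.posDef x (θ k)
  have e1 : matNorm (stats P a ε σ k).cov⁻¹ (stats P a ε σ k).b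
    = Real.sqrt (stats P a ε σ k).potential := rfl
  have e2 : matNorm (stats P a ε σ k).cov⁻¹ (stats P a r' σ k).b
      = Real.sqrt (stats P a r' σ k).potential := by
    rw [stats_cov_congr P a ε r' σ k]; rfl
  rw [e1] at h1
  rw [e2] at h2
  have h4 : P.lam * matNorm (stats P a ε σ k).cov⁻¹ (θ k) ≤ Real.sqrt P.lam * B := by
    have := matNorm_inv_le hS.posDef hl hS.posSemidef (θ k)
    have hs := Real.sqrt_pos.2 hl
    rw [le_div_iff₀ hs] at this
    calc P.lam * matNorm (stats P a ε σ k).cov⁻¹ (θ k)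
        = Real.sqrt P.lam * (matNorm (stats P a ε σ k).cov⁻¹ (θ k) * Real.sqrt P.lam) := by
          nth_rewrite 1 [← Real.mul_self_sqrt hl.le]; ring
      _ ≤ Real.sqrt P.lam * B := by gcongr; exact this.trans hB
  have hx := matNorm_nonneg (stats P a ε σ k).cov⁻¹ x
  rw [estimate_error P hl]
  have h5 : |P.lam * invForm (stats P a ε σ k).cov x.ofLp (θ k).ofLp|
      ≤ Real.sqrt P.lam * B * matNorm (stats P a ε σ k).cov⁻¹ x := by
    rw [abs_mul, abs_of_pos hl]
    calc _ ≤ P.lam * (matNorm (stats P a ε σ k).cov⁻¹ x * matNorm (stats P a ε σ k).cov⁻¹ (θ k)) :=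
          by gcongr
      _ = P.lam * matNorm (stats P a ε σ k).cov⁻¹ (θ k) * matNorm (stats P a ε σ k).cov⁻¹ x := by
          ring
      _ ≤ _ := by gcongr
  refine (abs_sub _ _).trans ((add_le_add (abs_add_le _ _) le_rfl).trans ?_)
  linarith

/-- The variation of the feature vectors over the `w` rounds before round `k`. -/
def localVariation (θ : ℕ → Vec d) (K w k : ℕ) : ℝ :=
  ∑ s ∈ Finset.Ico 1 K, if s < k ∧ k ≤ s + w then ‖θ (s + 1) - θ s‖ else 0

lemma localVariation_nonneg (θ : ℕ → Vec d) (K w k : ℕ) : 0 ≤ localVariation θ K w k :=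
  Finset.sum_nonneg fun s _ => by split_ifs <;> positivity

lemma norm_sub_le_localVariation (θ : ℕ → Vec d) {K w k t : ℕ} (hw : 1 ≤ w) (hk : k ≤ K)
    (ht : t ∈ Finset.Ico (max 1 (k - k % w)) k) :
    ‖θ t - θ k‖ ≤ localVariation θ K w k := by
  rw [Finset.mem_Ico] at ht
  have hm := Nat.mod_lt k hw
  have h1 : ‖θ t - θ k‖ ≤ ∑ s ∈ Finset.Ico t k, ‖θ (s + 1) - θ s‖ := by
    rw [← dist_eq_norm]
    refine (dist_le_Ico_sum_dist θ ht.2.le).trans (le_of_eq ?_)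
    exact Finset.sum_congr rfl fun s _ => by rw [dist_comm, dist_eq_norm]
  refine h1.trans ?_
  rw [localVariation, ← Finset.sum_filter]
  refine Finset.sum_le_sum_of_subset_of_nonneg (fun s hs => ?_) (fun _ _ _ => norm_nonneg _)
  simp only [Finset.mem_Ico, Finset.mem_filter] at hs ⊢
  omega

/-- After exchanging the sums, each jump `s` is seen only from the `w` rounds in `(s, s + w]`. -/
lemma sum_localVariation_le (θ : ℕ → Vec d) (K w : ℕ) :
    ∑ k ∈ Finset.Icc 1 K, localVariation θ K w k
      ≤ w * ∑ s ∈ Finset.Ico 1 K, ‖θ (s + 1) - θ s‖ := by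
  unfold localVariation
  rw [Finset.sum_comm, Finset.mul_sum]
  refine Finset.sum_le_sum fun s _ => ?_
  rw [← Finset.sum_filter, Finset.sum_const, nsmul_eq_mul]
  gcongr
  calc _ ≤ (Finset.Ioc s (s + w)).card := by
        apply Finset.card_le_card
        intro k hk
        simp only [Finset.mem_filter, Finset.mem_Ioc] at hk ⊢
        exact hk.2
    _ = w := by simp

lemma sqrt_potential_drift_le {P : Params} (hl : 0 < P.lam) (hα : 0 < P.α) (hw : 1 ≤ P.w)
    {a : ℕ → Vec d} (θ : ℕ → Vec d) (σ : ℕ → ℝ) {K k : ℕ} {A : ℝ} (hA : 0 ≤ A)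
    (ha : ∀ t ∈ Finset.Icc 1 K, ‖a t‖ ≤ A) (hk : k ∈ Finset.Icc 1 K) :
    Real.sqrt (stats P a (fun t => inner ℝ (θ t - θ k) (a t)) σ k).potential
      ≤ Real.sqrt P.w * A / P.α * localVariation θ K P.w k := by
  rw [Finset.mem_Icc] at hk
  have hV := localVariation_nonneg θ K P.w k
  refine Real.sqrt_le_iff.2 ⟨by positivity, ?_⟩
  refine (potential_stats_le hl hα a _ σ k hk.1).trans ?_
  have hb : ∀ t ∈ Finset.Ico (max 1 (k - k % P.w)) k,
      (inner ℝ (θ t - θ k) (a t)) ^ 2 / P.α ^ 2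
        ≤ (localVariation θ K P.w k * A) ^ 2 / P.α ^ 2 := by
    intro t ht
    have h1 := norm_sub_le_localVariation θ hw hk.2 ht
    rw [Finset.mem_Ico] at ht
    have h2 := ha t (Finset.mem_Icc.2 ⟨by omega, by omega⟩)
    have h3 : |inner ℝ (θ t - θ k) (a t)| ≤ localVariation θ K P.w k * A :=
      (abs_real_inner_le_norm _ _).trans (by gcongr)
    gcongr ?_ / _
    exact sq_le_sq' (abs_le.1 h3).1 (abs_le.1 h3).2
  refine (Finset.sum_le_card_nsmul _ _ _ hb).trans ?_
  have hc : ((Finset.Ico (max 1 (k - k % P.w)) k).card : ℝ) ≤ P.w := by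
    have := Nat.mod_lt k hw
    rw [Nat.card_Ico]; exact_mod_cast (by omega)
  rw [nsmul_eq_mul]
  calc _ ≤ (P.w : ℝ) * ((localVariation θ K P.w k * A) ^ 2 / P.α ^ 2) := by gcongr
    _ = _ := by
      rw [show (Real.sqrt P.w * A / P.α * localVariation θ K P.w k) ^ 2
        = Real.sqrt P.w ^ 2 * ((localVariation θ K P.w k * A) ^ 2 / P.α ^ 2) by ring,
        Real.sq_sqrt (Nat.cast_nonneg _)]

/-- Optimism: the arm played has the larger upper confidence bound, so the error terms at the
competitor cancel except for the drift. The drift is not covered by the radius and is paid once for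
each of the two arms, with `‖y‖_{Σ̂⁻¹} ≤ A / √λ`. -/
lemma instant_regret_le {P : Params} (hl : 0 < P.lam) (hα : 0 < P.α) (hw : 1 ≤ P.w)
    {a θ : ℕ → Vec d} {ε σ : ℕ → ℝ} {K k : ℕ} {A : ℝ} (hA : 0 ≤ A) {D : Set (Vec d)}
    {x : Vec d} (hD : ∀ y ∈ D, ‖y‖ ≤ A) (ha : ∀ t ∈ Finset.Icc 1 K, ‖a t‖ ≤ A)
    (hk : k ∈ Finset.Icc 1 K) (hθ : ‖θ k‖ ≤ P.B)
    (hmax : a k ∈ D ∧ IsMaxOn (ucb P (stats P a (reward θ a ε) σ k) k) D (a k)) (hx : x ∈ D)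
    (hgood : Real.sqrt (stats P a ε σ k).potential + Real.sqrt P.lam * P.B ≤ radius d P k) :
    inner ℝ x (θ k) - inner ℝ (a k) (θ k)
      ≤ 2 * (Real.sqrt P.w * A / P.α * (A / Real.sqrt P.lam)) * localVariation θ K P.w k
        + 2 * radius d P k * matNorm (stats P a ε σ k).cov⁻¹ (a k) := by
  have hS := stats_regular hl a ε σ k
  set Z := (stats P a ε σ k).cov with hZ
  set E := Real.sqrt P.w * A / P.α * localVariation θ K P.w k with hE
  have hV := localVariation_nonneg θ K P.w k
  have hE0 : 0 ≤ E := by positivity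
  have hdr := sqrt_potential_drift_le hl hα hw θ σ hA ha hk
  have hnorm : ∀ y ∈ D, matNorm Z⁻¹ y ≤ A / Real.sqrt P.lam := fun y hy =>
    (matNorm_inv_le hS.posDef hl hS.posSemidef y).trans (by gcongr; exact hD y hy)
  have herr : ∀ y ∈ D, |inner ℝ y (stats P a (reward θ a ε) σ k).estimate - inner ℝ y (θ k)|
      ≤ E * (A / Real.sqrt P.lam) + radius d P k * matNorm Z⁻¹ y := by
    intro y hy
    have h0 := matNorm_nonneg Z⁻¹ y
    refine (abs_estimate_error_le P hl a θ ε σ k hθ y).trans ?_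
    calc _ ≤ (E + radius d P k) * matNorm Z⁻¹ y := by
          apply mul_le_mul_of_nonneg_right _ h0
          linarith
      _ ≤ _ := by
          rw [add_mul]
          have := mul_le_mul_of_nonneg_left (hnorm y hy) hE0
          linarith
  have h1 := abs_le.1 (herr x hx)
  have h2 := abs_le.1 (herr (a k) hmax.1)
  have h3 : ucb P (stats P a (reward θ a ε) σ k) k x
      ≤ ucb P (stats P a (reward θ a ε) σ k) k (a k) := hmax.2 hx
  simp only [ucb, stats_cov_congr P a (reward θ a ε) ε σ k] at h3
  rw [← hZ] at h3
  have e : 2 * (Real.sqrt P.w * A / P.α * (A / Real.sqrt P.lam)) * localVariation θ K P.w k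
      = 2 * (E * (A / Real.sqrt P.lam)) := by rw [hE]; ring
  rw [e]
  linarith [h1.1, h1.2, h2.1, h2.2]

lemma le_two_mul_log_one_add {x : ℝ} (h0 : 0 ≤ x) (h1 : x ≤ 1) : x ≤ 2 * Real.log (1 + x) := by
  have h := Real.le_log_one_add_of_nonneg h0
  have : x / 2 ≤ 2 * x / (x + 2) := by
    rw [div_le_div_iff₀ (by norm_num) (by linarith)]; nlinarith
  linarith

/-- With `M` the norm on the left, `M² = W σ̄²`. If `σ` or `α` attains the maximum in `σ̄`, the
first term bounds `M`; if `γ √M` does, the identity becomes `M = γ² W`, the second term. -/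
lemma matNorm_le_weight {P : Params} (hα : 0 < P.α) (hγ : 0 < P.γ) {S : Stats d}
    (hS : S.Regular P) (a : Vec d) {σ : ℝ} (hσ : 0 ≤ σ) :
    matNorm S.cov⁻¹ a ≤ Real.sqrt (S.weight P a σ) * (σ + P.α) + P.γ ^ 2 * S.weight P a σ := by
  have hs : 0 < S.sigmaBar P a σ := hα.trans_le (le_sigmaBar P S a σ)
  have hw := hS.weight_nonneg a σ
  set M := matNorm S.cov⁻¹ a with hM
  have hM0 : 0 ≤ M := matNorm_nonneg _ _
  have hMsq : M ^ 2 = S.weight P a σ * S.sigmaBar P a σ ^ 2 := by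
    rw [hM, matNorm_inv, Real.sq_sqrt (invForm_self_nonneg hS.posDef _), Stats.weight]
    field_simp
  have hMe : M = Real.sqrt (S.weight P a σ) * S.sigmaBar P a σ := by
    rw [← Real.sqrt_sq hM0, hMsq, Real.sqrt_mul hw, Real.sqrt_sq hs.le]
  rcases le_total (P.γ * Real.sqrt M) (max σ P.α) with h | h
  · have hle : S.sigmaBar P a σ ≤ σ + P.α := by
      refine max_le (by linarith) (max_le (by linarith) (h.trans (max_le ?_ ?_))) <;> linarith
    calc M = Real.sqrt (S.weight P a σ) * S.sigmaBar P a σ := hMe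
      _ ≤ Real.sqrt (S.weight P a σ) * (σ + P.α) := by gcongr
      _ ≤ _ := by
        have : 0 ≤ P.γ ^ 2 * S.weight P a σ := by positivity
        linarith
  · have heq : S.sigmaBar P a σ = P.γ * Real.sqrt M := by
      apply le_antisymm
      · exact max_le ((le_max_left _ _).trans h) (max_le ((le_max_right _ _).trans h) le_rfl)
      · exact (le_max_right _ _).trans (le_max_right _ _)
    have hMpos : 0 < M := by
      rcases hM0.eq_or_lt with h0 | h0
      · rw [heq, ← h0] at hs; simp at hs
      · exact h0
    rw [heq, mul_pow, Real.sq_sqrt hM0] at hMsq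
    have : M = P.γ ^ 2 * S.weight P a σ := by
      apply mul_right_cancel₀ hMpos.ne'
      linarith
    have h2 : 0 ≤ Real.sqrt (S.weight P a σ) * (σ + P.α) := by positivity
    linarith

/-- For `W ≤ 1`, `W` is at most `2 log (1 + W)`. For `W ≥ 1` the trivial bound `x ≤ 2` is below `4
log 2`. -/
lemma instant_regret_le_log {P : Params} (hα : 0 < P.α) (hγ : 0 < P.γ) {S : Stats d}
    (hS : S.Regular P) (a : Vec d) {σ : ℝ} (hσ : 0 ≤ σ) {x E β : ℝ} (hE : 0 ≤ E) (hβ : 0 ≤ β)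
    (hx : x ≤ 2) (h : x ≤ E + 2 * β * matNorm S.cov⁻¹ a) :
    x ≤ E + 4 * Real.log (1 + S.weight P a σ)
      + 2 * β * (Real.sqrt (2 * Real.log (1 + S.weight P a σ)) * (σ + P.α)
        + 2 * P.γ ^ 2 * Real.log (1 + S.weight P a σ)) := by
  have hw := hS.weight_nonneg a σ
  have hM := matNorm_le_weight hα hγ hS a hσ
  set W := S.weight P a σ
  have hl : 0 ≤ Real.log (1 + W) := Real.log_nonneg (by linarith)
  rcases le_total W 1 with h1 | h1
  · have h2 := le_two_mul_log_one_add hw h1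
    have : matNorm S.cov⁻¹ a ≤ Real.sqrt (2 * Real.log (1 + W)) * (σ + P.α)
        + 2 * P.γ ^ 2 * Real.log (1 + W) := by
      refine hM.trans ?_
      have : P.γ ^ 2 * W ≤ P.γ ^ 2 * (2 * Real.log (1 + W)) := by gcongr
      have : Real.sqrt W * (σ + P.α) ≤ Real.sqrt (2 * Real.log (1 + W)) * (σ + P.α) := by gcongr
      linarith
    have := mul_le_mul_of_nonneg_left this (by linarith : 0 ≤ 2 * β)
    linarith
  · have h2 : Real.log 2 ≤ Real.log (1 + W) := Real.log_le_log (by norm_num) (by linarith)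
    have h3 := Real.log_two_gt_d9
    have : 0 ≤ 2 * β * (Real.sqrt (2 * Real.log (1 + W)) * (σ + P.α)
        + 2 * P.γ ^ 2 * Real.log (1 + W)) := by positivity
    linarith

/-- `log (1 + W)` is the increment of `log det`, so the sum telescopes in each window. The bound `J`
concerns the statistics after the update, since the last update of a window is discarded by the
restart. -/
lemma sum_log_weight_le {P : Params} (hl : 0 < P.lam) (hw : 1 ≤ P.w) {a : ℕ → Vec d}
    {r σ : ℕ → ℝ} {K : ℕ} {J : ℝ} (hK : 1 ≤ K)
    (hJ : ∀ k ∈ Finset.Icc 1 K,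
      ((stats P a r σ k).update P (a k) (r k) (σ k)).logDet P ≤ J) :
    ∑ k ∈ Finset.Icc 1 K, Real.log (1 + (stats P a r σ k).weight P (a k) (σ k))
      ≤ ((K / P.w : ℕ) + 1) * J := by
  have key : ∀ k, 1 ≤ k → k ≤ K →
      ∑ t ∈ Finset.Ico 1 k, Real.log (1 + (stats P a r σ t).weight P (a t) (σ t))
        ≤ (k / P.w : ℕ) * J + (stats P a r σ k).logDet P := by
    intro k hk
    induction k, hk using Nat.le_induction with
    | base =>
      intro _
      rw [stats_restart P a r σ (Params.IsRestart.one P), logDet_init hl]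
      rcases Nat.lt_or_ge 1 P.w with h | h
      · simp [Nat.div_eq_of_lt h]
      -- For `w = 1` the quotient `1 / w` is already 1, so `0 ≤ J` is needed; it comes from the
      -- hypothesis at round 1.
      · have h1 : P.w = 1 := by omega
        have hj := hJ 1 (Finset.mem_Icc.2 ⟨le_rfl, hK⟩)
        rw [(stats_regular hl a r σ 1).logDet_update hl, stats_restart P a r σ
          (Params.IsRestart.one P), logDet_init hl] at hj
        have hwn := (Stats.Regular.init (d := d) hl).weight_nonneg (a 1) (σ 1)
        have := Real.log_nonneg (x := 1 + (Stats.init d P).weight P (a 1) (σ 1)) (by linarith)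
        simp [h1]; linarith
    | succ k hk ih =>
      intro hkK
      have ih := ih (by omega)
      rw [Finset.sum_Ico_succ_top hk]
      have hu := (stats_regular hl a r σ k).logDet_update hl (a k) (r k) (σ k)
      have hj := hJ k (Finset.mem_Icc.2 ⟨hk, by omega⟩)
      by_cases h : P.IsRestart (k + 1)
      · have hdvd : P.w ∣ k + 1 := by
          rcases h with h | h
          · omega
          · exact Nat.dvd_of_mod_eq_zero h
        rw [stats_restart P a r σ h, logDet_init hl, Nat.succ_div, if_pos hdvd]
        push_cast
        linarith
      · have hdvd : ¬ P.w ∣ k + 1 := fun h' => h (Or.inr (Nat.mod_eq_zero_of_dvd h'))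
        rw [stats_update P a r σ h, Nat.succ_div, if_neg hdvd, add_zero]
        linarith
  have e : Finset.Icc 1 K = Finset.Ico 1 (K + 1) := by ext; simp
  rw [e, Finset.sum_Ico_succ_top hK]
  have h1 := key K hK le_rfl
  have hu := (stats_regular hl a r σ K).logDet_update hl (a K) (r K) (σ K)
  have hj := hJ K (Finset.mem_Icc.2 ⟨hK, le_rfl⟩)
  linarith

-- The extra one accounts for round 1, a restart whether or not `w` divides it.
open Classical in
lemma card_isRestart_le (P : Params) (K : ℕ) :
    ((Finset.Icc 1 K).filter P.IsRestart).card ≤ K / P.w + 1 := by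
  have hsub : (Finset.Icc 1 K).filter P.IsRestart
      ⊆ (Finset.Ioc 0 K).filter (fun k => P.w ∣ k) ∪ {1} := by
    intro k hk
    simp only [Finset.mem_filter, Finset.mem_Icc, Finset.mem_union, Finset.mem_Ioc,
      Finset.mem_singleton] at hk ⊢
    rcases hk.2 with h | h
    · exact Or.inr h
    · exact Or.inl ⟨by omega, Nat.dvd_of_mod_eq_zero h⟩
  refine (Finset.card_le_card hsub).trans ((Finset.card_union_le _ _).trans ?_)
  rw [Nat.Ioc_filter_dvd_card_eq_div]
  simp

/-- The rounds other than restarts in which the noise leaves the confidence ellipsoid. -/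
def IsBad (d : ℕ) (P : Params) (a : ℕ → Vec d) (ε σ : ℕ → ℝ) (k : ℕ) : Prop :=
  ¬ P.IsRestart k ∧
    radius d P k - Real.sqrt P.lam * P.B < Real.sqrt (stats P a ε σ k).potential

open Classical in
/-- The regret bound in terms of the number of rounds with an invalid confidence ellipsoid. -/
theorem regret_le_of_card_isBad {P : Params} (hl : 0 < P.lam) (hα : 0 < P.α) (hγ : 0 < P.γ)
    (hw : 1 ≤ P.w) {a aStar θ : ℕ → Vec d} {ε σ : ℕ → ℝ} {K : ℕ} (hK : 1 ≤ K) {A BK VK J β N : ℝ}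
    (hA : 0 ≤ A) {D : ℕ → Set (Vec d)} (hD : ∀ k ∈ Finset.Icc 1 K, ∀ x ∈ D k, ‖x‖ ≤ A)
    (hmean : ∀ k ∈ Finset.Icc 1 K, ∀ x ∈ D k, inner ℝ x (θ k) ∈ Set.Icc (-1 : ℝ) 1)
    (hθ : ∀ k ∈ Finset.Icc 1 K, ‖θ k‖ ≤ P.B) (hσ : ∀ k ∈ Finset.Icc 1 K, 0 ≤ σ k)
    (hBK : ∑ k ∈ Finset.Ico 1 K, ‖θ (k + 1) - θ k‖ ≤ BK)
    (hVK : ∑ k ∈ Finset.Icc 1 K, σ k ^ 2 ≤ VK)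
    (hrun : IsRun P K D a (reward θ a ε) σ)
    (hstar : ∀ k ∈ Finset.Icc 1 K, aStar k ∈ D k)
    (hβ0 : 0 ≤ β) (hβ : ∀ k ∈ Finset.Icc 1 K, ¬ P.IsRestart k → radius d P k ≤ β)
    (hJ0 : 0 ≤ J) (hJ : ∀ k ∈ Finset.Icc 1 K,
      ((stats P a ε σ k).update P (a k) (ε k) (σ k)).logDet P ≤ J)
    (hN : ((K / P.w : ℕ) + 1 : ℝ) ≤ N)
    (hbad : (((Finset.Icc 1 K).filter (IsBad d P a ε σ)).card : ℝ) ≤ N) :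
    regret K θ aStar a ≤ 4 * N
      + 2 * (Real.sqrt P.w * A / P.α * (A / Real.sqrt P.lam)) * (P.w * BK)
      + 4 * (N * J) + 2 * β * (Real.sqrt (2 * (N * J)) * Real.sqrt (2 * VK + 2 * K * P.α ^ 2)
        + 2 * P.γ ^ 2 * (N * J)) := by
  have ha : ∀ t ∈ Finset.Icc 1 K, ‖a t‖ ≤ A := fun t ht => hD t ht _ (hrun t ht).1
  set l : ℕ → ℝ := fun k => Real.log (1 + (stats P a ε σ k).weight P (a k) (σ k)) with hldef
  have hl0 : ∀ k, 0 ≤ l k := fun k => Real.log_nonneg (by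
    have := (stats_regular hl a ε σ k).weight_nonneg (a k) (σ k); linarith)
  have hsuml : ∑ k ∈ Finset.Icc 1 K, l k ≤ N * J :=
    (sum_log_weight_le hl hw hK hJ).trans (by gcongr)
  set c := 2 * (Real.sqrt P.w * A / P.α * (A / Real.sqrt P.lam)) with hc
  have hc0 : 0 ≤ c := by positivity
  -- Restarts and bad rounds are charged the trivial regret 2; the remaining terms are nonnegative
  -- and may stay for every round.
  have hround : ∀ k ∈ Finset.Icc 1 K, inner ℝ (aStar k) (θ k) - inner ℝ (a k) (θ k)
      ≤ (if P.IsRestart k then 2 else 0) + (if IsBad d P a ε σ k then 2 else 0)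
        + c * localVariation θ K P.w k + 4 * l k
        + 2 * β * (Real.sqrt (2 * l k) * (σ k + P.α) + 2 * P.γ ^ 2 * l k) := by
    intro k hk
    have hV := localVariation_nonneg θ K P.w k
    have h1 := (hmean k hk _ (hstar k hk)).2
    have h2 := (hmean k hk _ (hrun k hk).1).1
    have hσk := hσ k hk
    have hlk := hl0 k
    have hnn : 0 ≤ c * localVariation θ K P.w k + 4 * l k
        + 2 * β * (Real.sqrt (2 * l k) * (σ k + P.α) + 2 * P.γ ^ 2 * l k) := by positivity
    by_cases hr : P.IsRestart k
    · rw [if_pos hr]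
      split_ifs <;> linarith
    by_cases hb : IsBad d P a ε σ k
    · rw [if_pos hb, if_neg hr]
      linarith
    rw [if_neg hr, if_neg hb]
    have hgood : Real.sqrt (stats P a ε σ k).potential + Real.sqrt P.lam * P.B ≤ radius d P k := by
      by_contra hcon
      exact hb ⟨hr, by linarith⟩
    have hreg := instant_regret_le hl hα hw hA (hD k hk) ha hk (hθ k hk) (hrun k hk)
      (hstar k hk) hgood
    have hM := matNorm_nonneg (stats P a ε σ k).cov⁻¹ (a k)
    have := instant_regret_le_log hα hγ (stats_regular hl a ε σ k) (a k) hσk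
      (mul_nonneg hc0 hV) hβ0 (x := inner ℝ (aStar k) (θ k) - inner ℝ (a k) (θ k))
      (by linarith) (hreg.trans (by gcongr; exact hβ k hk hr))
    linarith
  have hR : ∑ k ∈ Finset.Icc 1 K, (if P.IsRestart k then (2 : ℝ) else 0) ≤ 2 * N := by
    rw [← Finset.sum_filter, Finset.sum_const, nsmul_eq_mul, mul_comm]
    have : (((Finset.Icc 1 K).filter P.IsRestart).card : ℝ) ≤ (K / P.w : ℕ) + 1 := by
      exact_mod_cast card_isRestart_le P K
    linarith
  have hB : ∑ k ∈ Finset.Icc 1 K, (if IsBad d P a ε σ k then (2 : ℝ) else 0) ≤ 2 * N := by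
    rw [← Finset.sum_filter, Finset.sum_const, nsmul_eq_mul, mul_comm]
    linarith
  have hdrift : ∑ k ∈ Finset.Icc 1 K, c * localVariation θ K P.w k ≤ c * (P.w * BK) := by
    rw [← Finset.mul_sum]
    gcongr
    exact (sum_localVariation_le θ K P.w).trans (by gcongr)
  -- Cauchy–Schwarz over the rounds is what brings in the total variance rather than the sum of
  -- standard deviations.
  have hcs : ∑ k ∈ Finset.Icc 1 K, Real.sqrt (2 * l k) * (σ k + P.α)
      ≤ Real.sqrt (2 * (N * J)) * Real.sqrt (2 * VK + 2 * K * P.α ^ 2) := by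
    refine (Real.sum_mul_le_sqrt_mul_sqrt _ _ _).trans ?_
    gcongr ?_ * ?_
    · apply Real.sqrt_le_sqrt
      calc ∑ k ∈ Finset.Icc 1 K, Real.sqrt (2 * l k) ^ 2 = ∑ k ∈ Finset.Icc 1 K, 2 * l k :=
            Finset.sum_congr rfl fun k _ => Real.sq_sqrt (by linarith [hl0 k])
        _ ≤ _ := by rw [← Finset.mul_sum]; linarith
    · apply Real.sqrt_le_sqrt
      calc ∑ k ∈ Finset.Icc 1 K, (σ k + P.α) ^ 2
          ≤ ∑ k ∈ Finset.Icc 1 K, (2 * σ k ^ 2 + 2 * P.α ^ 2) :=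
            Finset.sum_le_sum fun k _ => by nlinarith [sq_nonneg (σ k - P.α)]
        _ ≤ _ := by
            rw [Finset.sum_add_distrib, ← Finset.mul_sum, Finset.sum_const, Nat.card_Icc]
            simp only [Nat.add_sub_cancel, nsmul_eq_mul]
            linarith
  have hg : 2 * P.γ ^ 2 * ∑ k ∈ Finset.Icc 1 K, l k ≤ 2 * P.γ ^ 2 * (N * J) := by gcongr
  calc regret K θ aStar a ≤ _ := Finset.sum_le_sum hround
    _ ≤ _ := by
      simp only [Finset.sum_add_distrib, ← Finset.mul_sum] at hdrift ⊢
      have := mul_le_mul_of_nonneg_left (add_le_add hcs hg) (by linarith : 0 ≤ 2 * β)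
      linarith

end Regret

/-! ### One step of the exponential supermartingale -/

section ExponentialPotential

variable {d : ℕ}

/-- The exponential potential `exp (s √(ρ² + ‖b̂‖²_{Σ̂⁻¹}) - κ log det (Σ̂ / λ))`. -/
def Stats.expPotential (P : Params) (ρ s κ : ℝ) (S : Stats d) : ℝ :=
  Real.exp (s * Real.sqrt (ρ ^ 2 + S.potential) - κ * S.logDet P)

/-- The coefficient of the noise in the bound for the updated exponential potential. -/
def Stats.linCoeff (P : Params) (ρ s : ℝ) (S : Stats d) (a : Vec d) (σ : ℝ) : ℝ :=
  s * (invForm S.cov a.ofLp S.b.ofLp / S.sigmaBar P a σ)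
    / ((1 + S.weight P a σ) * Real.sqrt (ρ ^ 2 + S.potential)) / S.sigmaBar P a σ

/-- The coefficient of the squared noise in the bound for the updated exponential potential. -/
def Stats.quadCoeff (P : Params) (κ : ℝ) (S : Stats d) (a : Vec d) (σ : ℝ) : ℝ :=
  κ * (S.weight P a σ / (1 + S.weight P a σ)) / S.sigmaBar P a σ ^ 2

lemma Stats.Regular.potential_nonneg {P : Params} {S : Stats d} (hS : S.Regular P) :
    0 ≤ S.potential := invForm_self_nonneg hS.posDef _

lemma exp_le_one_add_add_sq {x : ℝ} (hx : x ≤ 1) : Real.exp x ≤ 1 + x + x ^ 2 := by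
  rcases le_total (-1) x with h | h
  · have := Real.abs_exp_sub_one_sub_id_le (abs_le.2 ⟨h, hx⟩)
    linarith [(abs_le.1 this).2]
  · have h1 : Real.exp x ≤ 1 := Real.exp_le_one_iff.2 (by linarith)
    nlinarith

lemma sqrt_add_le_add_div {g z : ℝ} (hg : 0 < g) (h : 0 ≤ g ^ 2 + z) :
    Real.sqrt (g ^ 2 + z) ≤ g + z / (2 * g) := by
  have h1 : 0 ≤ g + z / (2 * g) := by
    have : g + z / (2 * g) = (g ^ 2 + (g ^ 2 + z)) / (2 * g) := by field_simp; ring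
    rw [this]; positivity
  refine Real.sqrt_le_iff.2 ⟨h1, ?_⟩
  have : (g + z / (2 * g)) ^ 2 = g ^ 2 + z + (z / (2 * g)) ^ 2 := by field_simp; ring
  rw [this]
  linarith [sq_nonneg (z / (2 * g))]

/-- One step of the potential: its square root grows by at most a linear and a quadratic term in
the noise, each of them small. -/
lemma sqrt_potential_update_le {P : Params} (hα : 0 < P.α) (hγ : 0 < P.γ) {S : Stats d}
    (hS : S.Regular P) (a : Vec d) {r σ ρ : ℝ} (hr : |r| ≤ P.R) (hρ : P.R / P.γ ^ 2 ≤ ρ)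
    (hρ0 : 0 < ρ) :
    ∃ h₁ h₂ : ℝ,
      h₁ = invForm S.cov a.ofLp S.b.ofLp / S.sigmaBar P a σ
          / ((1 + S.weight P a σ) * Real.sqrt (ρ ^ 2 + S.potential)) ∧
      Real.sqrt (ρ ^ 2 + (S.update P a r σ).potential)
        ≤ Real.sqrt (ρ ^ 2 + S.potential) + (r / S.sigmaBar P a σ * h₁
          + (r / S.sigmaBar P a σ) ^ 2 * h₂) ∧
      h₁ ^ 2 ≤ S.weight P a σ / (1 + S.weight P a σ) ∧
      0 ≤ h₂ ∧ h₂ ≤ S.weight P a σ / (1 + S.weight P a σ) / (2 * ρ) ∧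
      |r / S.sigmaBar P a σ * h₁| ≤ P.R / P.γ ^ 2 ∧
      (r / S.sigmaBar P a σ) ^ 2 * h₂ ≤ P.R / P.γ ^ 2 / 2 := by
  have hs : 0 < S.sigmaBar P a σ := hα.trans_le (le_sigmaBar P S a σ)
  have hw := hS.weight_nonneg a σ
  have hΦ := hS.potential_nonneg
  have hR : 0 ≤ P.R := (abs_nonneg r).trans hr
  set W := S.weight P a σ with hW
  set y := invForm S.cov a.ofLp S.b.ofLp / S.sigmaBar P a σ with hy
  set η := r / S.sigmaBar P a σ with hη
  set g := Real.sqrt (ρ ^ 2 + S.potential) with hg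
  have hg2 : g ^ 2 = ρ ^ 2 + S.potential := Real.sq_sqrt (by positivity)
  have hρg : ρ ≤ g := Real.le_sqrt_of_sq_le (by linarith)
  have hg0 : 0 < g := hρ0.trans_le hρg
  have hy2 : y ^ 2 ≤ W * S.potential := by
    have := invForm_sq_le hS.posDef a.ofLp S.b.ofLp
    rw [hy, hW, Stats.weight, Stats.potential, div_pow, div_le_iff₀ (by positivity)]
    field_simp
    exact this
  have hyg : y ^ 2 ≤ W * g ^ 2 := hy2.trans (by rw [hg2]; gcongr; nlinarith)
  -- The purpose of the floor with `γ`: from `σ̄² ≥ γ² ‖a‖_{Σ̂⁻¹}` follows `γ⁴ W ≤ σ̄²`, so an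
  -- atypically informative arm cannot produce a large jump.
  have hηW : η ^ 2 * W ≤ (P.R / P.γ ^ 2) ^ 2 := by
    have h1 := gamma_sq_mul_le_sigmaBar_sq hγ.le S a σ
    have h2 : matNorm S.cov⁻¹ a ^ 2 = W * S.sigmaBar P a σ ^ 2 := by
      rw [matNorm_inv, Real.sq_sqrt (invForm_self_nonneg hS.posDef _), hW, Stats.weight]
      field_simp
    have h3 : r ^ 2 ≤ P.R ^ 2 := sq_le_sq' (abs_le.1 hr).1 (abs_le.1 hr).2
    have h4 : (P.γ ^ 2 * matNorm S.cov⁻¹ a) ^ 2 ≤ (S.sigmaBar P a σ ^ 2) ^ 2 := by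
      have := matNorm_nonneg S.cov⁻¹ a
      gcongr
    rw [mul_pow, h2] at h4
    have h5 : (P.γ ^ 2) ^ 2 * W ≤ S.sigmaBar P a σ ^ 2 := by
      have : 0 < S.sigmaBar P a σ ^ 2 := by positivity
      nlinarith
    rw [hη, div_pow, div_pow, div_mul_eq_mul_div, div_le_div_iff₀ (by positivity) (by positivity)]
    calc r ^ 2 * W * (P.γ ^ 2) ^ 2 = r ^ 2 * ((P.γ ^ 2) ^ 2 * W) := by ring
      _ ≤ P.R ^ 2 * S.sigmaBar P a σ ^ 2 := by gcongr
  have hb0 : 0 ≤ P.R / P.γ ^ 2 := by positivity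
  have hq : W / (1 + W) ≤ W := div_le_self hw (by linarith)
  have hh1 : (y / ((1 + W) * g)) ^ 2 ≤ W / (1 + W) := by
    rw [div_pow, mul_pow, div_le_div_iff₀ (by positivity) (by positivity)]
    calc y ^ 2 * (1 + W) ≤ W * g ^ 2 * (1 + W) := by gcongr
      _ ≤ W * g ^ 2 * (1 + W) ^ 2 := by gcongr; nlinarith
      _ = _ := by ring
  have hh2 : W / (1 + W) / (2 * g) ≤ W / (1 + W) / (2 * ρ) := by gcongr
  refine ⟨y / ((1 + W) * g), W / (1 + W) / (2 * g), rfl, ?_, hh1, by positivity, hh2, ?_, ?_⟩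
  · have hup : ρ ^ 2 + (S.update P a r σ).potential
        ≤ g ^ 2 + (2 * η * y / (1 + W) + η ^ 2 * (W / (1 + W))) := by
      rw [potential_update hα hS, hg2]
      -- The favourable term `-y²` is dropped; then `√(g² + z) ≤ g + z / (2g)` separates linear and
      -- quadratic noise.
      have : (2 * η * y + η ^ 2 * W - y ^ 2) / (1 + W)
          ≤ 2 * η * y / (1 + W) + η ^ 2 * (W / (1 + W)) := by
        rw [show 2 * η * y / (1 + W) + η ^ 2 * (W / (1 + W))
          = (2 * η * y + η ^ 2 * W) / (1 + W) by ring]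
        gcongr
        linarith [sq_nonneg y]
      linarith
    have hnn : 0 ≤ ρ ^ 2 + (S.update P a r σ).potential := by
      have := (hS.update a r σ).potential_nonneg
      positivity
    refine (Real.sqrt_le_sqrt hup).trans ((sqrt_add_le_add_div hg0 (hnn.trans hup)).trans
      (le_of_eq ?_))
    field_simp
  · apply abs_le_of_sq_le_sq _ hb0
    calc (η * (y / ((1 + W) * g))) ^ 2 = η ^ 2 * (y / ((1 + W) * g)) ^ 2 := by ring
      _ ≤ η ^ 2 * W := by gcongr; exact hh1.trans hq
      _ ≤ _ := hηW
  · calc η ^ 2 * (W / (1 + W) / (2 * g)) ≤ η ^ 2 * (W / (2 * ρ)) := by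
          gcongr
      _ = η ^ 2 * W / (2 * ρ) := by ring
      _ ≤ (P.R / P.γ ^ 2) ^ 2 / (2 * ρ) := by gcongr
      _ ≤ P.R / P.γ ^ 2 / 2 := by
          rw [div_le_div_iff₀ (by positivity) (by positivity)]
          nlinarith

/-- The increment `X` of the square root satisfies `s X ≤ 1`, so `exp (s X) ≤ 1 + s X + (s X)²`.
Everything beyond the linear noise term is dominated by a multiple of `r²`, whose expectation the
variance controls. The first conclusion only provides boundedness for the induction over rounds. -/
lemma expPotential_update_le {P : Params} (hl : 0 < P.lam) (hα : 0 < P.α) (hγ : 0 < P.γ)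
    {S : Stats d} (hS : S.Regular P) (a : Vec d) {r σ ρ s κ : ℝ} (hr : |r| ≤ P.R)
    (hρ : P.R / P.γ ^ 2 ≤ ρ) (hρ0 : 0 < ρ) (hs : 0 < s) (hsb : s * (3 / 2 * (P.R / P.γ ^ 2)) ≤ 1)
    (hκ : κ = s / (2 * ρ) + 5 / 2 * s ^ 2) :
    (S.update P a r σ).expPotential P ρ s κ ≤ S.expPotential P ρ s κ * Real.exp 1 ∧
    (S.update P a r σ).expPotential P ρ s κ
      ≤ S.expPotential P ρ s κ * Real.exp (-(κ * Real.log (1 + S.weight P a σ)))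
        * (1 + S.linCoeff P ρ s a σ * r + S.quadCoeff P κ a σ * r ^ 2) := by
  obtain ⟨h₁, h₂, e1, hstep, hh1, hh20, hh2, hb1, hb2⟩ :=
    sqrt_potential_update_le hα hγ hS a (σ := σ) hr hρ hρ0
  have hsp : 0 < S.sigmaBar P a σ := hα.trans_le (le_sigmaBar P S a σ)
  have hw := hS.weight_nonneg a σ
  have hlog : 0 ≤ Real.log (1 + S.weight P a σ) := Real.log_nonneg (by linarith)
  have hκ0 : 0 ≤ κ := by rw [hκ]; positivity
  set η := r / S.sigmaBar P a σ with hη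
  set q := S.weight P a σ / (1 + S.weight P a σ) with hq
  set b := P.R / P.γ ^ 2 with hbdef
  have hq0 : 0 ≤ q := by positivity
  have hb0 : 0 ≤ b := (abs_nonneg _).trans hb1
  set X := η * h₁ + η ^ 2 * h₂ with hX
  have hX1 : s * X ≤ 1 := by
    have : X ≤ 3 / 2 * b := by linarith [(abs_le.1 hb1).2]
    exact (mul_le_mul_of_nonneg_left this hs.le).trans hsb
  have hmain : (S.update P a r σ).expPotential P ρ s κ
      ≤ S.expPotential P ρ s κ * Real.exp (-(κ * Real.log (1 + S.weight P a σ)))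
        * Real.exp (s * X) := by
    rw [Stats.expPotential, Stats.expPotential, ← Real.exp_add, ← Real.exp_add, Real.exp_le_exp,
      hS.logDet_update hl]
    have := mul_le_mul_of_nonneg_left hstep hs.le
    linarith
  have hF : 0 < S.expPotential P ρ s κ := Real.exp_pos _
  refine ⟨hmain.trans ?_, hmain.trans ?_⟩
  · gcongr
    exact mul_le_of_le_one_right hF.le (Real.exp_le_one_iff.2 (by nlinarith))
  · gcongr
    refine (exp_le_one_add_add_sq hX1).trans ?_
    have e3 : S.linCoeff P ρ s a σ * r = s * (η * h₁) := by
      rw [Stats.linCoeff, hη, e1]; ring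
    have e4 : S.quadCoeff P κ a σ * r ^ 2 = η ^ 2 * (κ * q) := by
      rw [Stats.quadCoeff, hη]; ring
    rw [e3, e4]
    have hXsq : X ^ 2 ≤ η ^ 2 * (2 * h₁ ^ 2 + b * h₂) := by
      have h5 : (η ^ 2 * h₂) ^ 2 ≤ b / 2 * (η ^ 2 * h₂) := by
        rw [sq]; gcongr
      have h6 : X ^ 2 ≤ 2 * (η * h₁) ^ 2 + 2 * (η ^ 2 * h₂) ^ 2 := by
        rw [hX]; nlinarith [sq_nonneg (η * h₁ - η ^ 2 * h₂)]
      calc X ^ 2 ≤ 2 * (η * h₁) ^ 2 + 2 * (b / 2 * (η ^ 2 * h₂)) := by linarith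
        _ = _ := by ring
    have hbh : b * h₂ ≤ q / 2 := by
      calc b * h₂ ≤ ρ * (q / (2 * ρ)) := by gcongr
        _ = q / 2 := by field_simp
    -- This dictates `κ`: `s / (2ρ)` is the quadratic term of the square root, and `5/2 = 2 + 1/2`
    -- collects the two parts of `X²`.
    have hcoef : s * h₂ + s ^ 2 * (2 * h₁ ^ 2 + b * h₂) ≤ κ * q := by
      calc _ ≤ s * (q / (2 * ρ)) + s ^ 2 * (2 * q + q / 2) := by gcongr
        _ = κ * q := by rw [hκ]; ring
    calc 1 + s * X + (s * X) ^ 2 = 1 + s * X + s ^ 2 * X ^ 2 := by ring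
      _ ≤ 1 + s * X + s ^ 2 * (η ^ 2 * (2 * h₁ ^ 2 + b * h₂)) := by gcongr
      _ = 1 + s * (η * h₁) + η ^ 2 * (s * h₂ + s ^ 2 * (2 * h₁ ^ 2 + b * h₂)) := by
        rw [hX]; ring
      _ ≤ _ := by gcongr

lemma abs_linCoeff_le {P : Params} (hα : 0 < P.α) {S : Stats d} (hS : S.Regular P) (a : Vec d)
    {σ ρ s : ℝ} (hρ0 : 0 < ρ) (hs : 0 < s) : |S.linCoeff P ρ s a σ| ≤ s / P.α := by
  have hsp : 0 < S.sigmaBar P a σ := hα.trans_le (le_sigmaBar P S a σ)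
  have hw := hS.weight_nonneg a σ
  have hΦ := hS.potential_nonneg
  have hy2 : (invForm S.cov a.ofLp S.b.ofLp / S.sigmaBar P a σ) ^ 2
      ≤ S.weight P a σ * S.potential := by
    have := invForm_sq_le hS.posDef a.ofLp S.b.ofLp
    rw [Stats.weight, Stats.potential, div_pow, div_le_iff₀ (by positivity)]
    field_simp
    exact this
  set W := S.weight P a σ
  set y := invForm S.cov a.ofLp S.b.ofLp / S.sigmaBar P a σ
  set g := Real.sqrt (ρ ^ 2 + S.potential) with hg
  have hg2 : g ^ 2 = ρ ^ 2 + S.potential := Real.sq_sqrt (by positivity)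
  have hg0 : 0 < g := Real.sqrt_pos.2 (by positivity)
  have h1 : |y / ((1 + W) * g)| ≤ 1 := by
    apply (sq_le_one_iff_abs_le_one _).1
    rw [div_pow, div_le_one (by positivity), mul_pow, hg2]
    nlinarith [sq_nonneg W, mul_nonneg hw hΦ, sq_nonneg ρ, mul_nonneg hw (sq_nonneg ρ),
      mul_nonneg (sq_nonneg W) (sq_nonneg ρ), mul_nonneg (sq_nonneg W) hΦ]
  have e : S.linCoeff P ρ s a σ = s * (y / ((1 + W) * g)) / S.sigmaBar P a σ := by
    rw [Stats.linCoeff]; ring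
  rw [e, abs_div, abs_mul, abs_of_pos hs, abs_of_pos hsp]
  have := le_sigmaBar P S a σ
  calc _ ≤ s * 1 / P.α := by gcongr
    _ = _ := by rw [mul_one]

lemma quadCoeff_nonneg {P : Params} {S : Stats d} (hS : S.Regular P) (a : Vec d)
    {σ κ : ℝ} (hκ : 0 ≤ κ) : 0 ≤ S.quadCoeff P κ a σ := by
  have hw := hS.weight_nonneg a σ
  unfold Stats.quadCoeff
  positivity

lemma quadCoeff_le {P : Params} (hα : 0 < P.α) {S : Stats d} (hS : S.Regular P) (a : Vec d)
    {σ κ : ℝ} (hκ : 0 ≤ κ) : S.quadCoeff P κ a σ ≤ κ / P.α ^ 2 := by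
  have hw := hS.weight_nonneg a σ
  have h1 : S.weight P a σ / (1 + S.weight P a σ) ≤ 1 := (div_le_one (by linarith)).2 (by linarith)
  have := le_sigmaBar P S a σ
  unfold Stats.quadCoeff
  calc _ ≤ κ * 1 / P.α ^ 2 := by gcongr
    _ = _ := by rw [mul_one]

/-- Because `σ ≤ σ̄`, the variance term is at most `κ W / (1 + W) ≤ κ log (1 + W)`, exactly what the
compensator `κ log det` gains in this step. -/
lemma exp_neg_mul_one_add_quadCoeff_le {P : Params} (hα : 0 < P.α) {S : Stats d}
    (hS : S.Regular P) (a : Vec d) {σ κ : ℝ} (hκ : 0 ≤ κ) (hσ : 0 ≤ σ) :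
    Real.exp (-(κ * Real.log (1 + S.weight P a σ))) * (1 + S.quadCoeff P κ a σ * σ ^ 2) ≤ 1 := by
  have hw := hS.weight_nonneg a σ
  have hsp : 0 < S.sigmaBar P a σ := hα.trans_le (le_sigmaBar P S a σ)
  have h1 := Real.one_sub_inv_le_log_of_pos (by linarith : 0 < 1 + S.weight P a σ)
  have h2 : S.weight P a σ / (1 + S.weight P a σ) = 1 - (1 + S.weight P a σ)⁻¹ := by
    field_simp; ring
  have h3 : S.quadCoeff P κ a σ * σ ^ 2 ≤ κ * Real.log (1 + S.weight P a σ) := by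
    have hss := sigma_le_sigmaBar P S a σ
    calc S.quadCoeff P κ a σ * σ ^ 2
        ≤ S.quadCoeff P κ a σ * S.sigmaBar P a σ ^ 2 := by
          have := quadCoeff_nonneg hS a (σ := σ) hκ
          gcongr
      _ = κ * (S.weight P a σ / (1 + S.weight P a σ)) := by rw [Stats.quadCoeff]; field_simp
      _ ≤ _ := by rw [h2]; gcongr
  have h4 := Real.add_one_le_exp (κ * Real.log (1 + S.weight P a σ))
  calc _ ≤ Real.exp (-(κ * Real.log (1 + S.weight P a σ)))
        * Real.exp (κ * Real.log (1 + S.weight P a σ)) := by gcongr; linarith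
    _ = 1 := by rw [← Real.exp_add]; simp

end ExponentialPotential

/-! ### Measurability of the statistics -/

section Measurability

/-- Entrywise measurability of random statistics. -/
structure MeasurableStats {d : ℕ} {Ω : Type*} [MeasurableSpace Ω] (S : Ω → Stats d) : Prop where
  cov : ∀ i j, Measurable fun ω => (S ω).cov i j
  b : Measurable fun ω => (S ω).b

variable {d : ℕ} {Ω : Type*} {m : MeasurableSpace Ω}

lemma measurable_det {n : ℕ} {Z : Ω → Matrix (Fin n) (Fin n) ℝ}
    (hZ : ∀ i j, Measurable fun ω => Z ω i j) : Measurable fun ω => (Z ω).det := by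
  simp only [Matrix.det_apply]
  exact Finset.measurable_sum _ fun p _ =>
    (Finset.measurable_prod _ fun i _ => hZ _ _).const_smul _

lemma measurable_inv_apply {Z : Ω → Matrix (Fin d) (Fin d) ℝ}
    (hZ : ∀ i j, Measurable fun ω => Z ω i j) (i j : Fin d) :
    Measurable fun ω => (Z ω)⁻¹ i j := by
  simp only [Matrix.inv_def, Ring.inverse_eq_inv', Matrix.smul_apply, smul_eq_mul,
    Matrix.adjugate_apply]
  refine (measurable_det hZ).inv.mul (measurable_det fun k l => ?_)
  by_cases h : k = j
  · subst h; simp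
  · simp only [Matrix.updateRow_ne h]; exact hZ k l

lemma measurable_invForm {Z : Ω → Matrix (Fin d) (Fin d) ℝ} {x y : Ω → Vec d}
    (hZ : ∀ i j, Measurable fun ω => Z ω i j) (hx : Measurable x) (hy : Measurable y) :
    Measurable fun ω => invForm (Z ω) (x ω).ofLp (y ω).ofLp := by
  have hc : ∀ {z : Ω → Vec d}, Measurable z → ∀ i, Measurable fun ω => (z ω).ofLp i :=
    fun {z} hz i => (PiLp.continuous_apply 2 (fun _ : Fin d => ℝ) i).measurable.comp hz
  simp only [invForm, dotProduct, Matrix.mulVec]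
  exact Finset.measurable_sum _ fun i _ => (hc hx i).mul
    (Finset.measurable_sum _ fun j _ => (measurable_inv_apply hZ i j).mul (hc hy j))

variable {S : Ω → Stats d} {a : Ω → Vec d} {r σ : Ω → ℝ}

lemma MeasurableStats.sigmaBar (P : Params) (hS : MeasurableStats S) (ha : Measurable a)
    (hσ : Measurable σ) : Measurable fun ω => (S ω).sigmaBar P (a ω) (σ ω) := by
  have h := (measurable_invForm hS.cov ha ha).sqrt.sqrt
  exact hσ.max (measurable_const.max (h.const_mul _))

lemma MeasurableStats.weight (P : Params) (hS : MeasurableStats S) (ha : Measurable a)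
    (hσ : Measurable σ) : Measurable fun ω => (S ω).weight P (a ω) (σ ω) :=
  (((hS.sigmaBar P ha hσ).pow_const 2).const_div 1).mul (measurable_invForm hS.cov ha ha)

lemma MeasurableStats.potential (hS : MeasurableStats S) :
    Measurable fun ω => (S ω).potential := measurable_invForm hS.cov hS.b hS.b

lemma MeasurableStats.logDet (P : Params) (hS : MeasurableStats S) :
    Measurable fun ω => (S ω).logDet P := ((measurable_det hS.cov).div_const _).log

lemma MeasurableStats.expPotential (P : Params) (ρ s κ : ℝ) (hS : MeasurableStats S) :
    Measurable fun ω => (S ω).expPotential P ρ s κ :=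
  (((hS.potential.const_add _).sqrt.const_mul _).sub ((hS.logDet P).const_mul _)).exp

lemma MeasurableStats.linCoeff (P : Params) (ρ s : ℝ) (hS : MeasurableStats S)
    (ha : Measurable a) (hσ : Measurable σ) :
    Measurable fun ω => (S ω).linCoeff P ρ s (a ω) (σ ω) :=
  ((((measurable_invForm hS.cov ha hS.b).div (hS.sigmaBar P ha hσ)).const_mul _).div
    (((hS.weight P ha hσ).const_add _).mul (hS.potential.const_add _).sqrt)).div
    (hS.sigmaBar P ha hσ)

lemma MeasurableStats.quadCoeff (P : Params) (κ : ℝ) (hS : MeasurableStats S)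
    (ha : Measurable a) (hσ : Measurable σ) :
    Measurable fun ω => (S ω).quadCoeff P κ (a ω) (σ ω) :=
  (((hS.weight P ha hσ).div ((hS.weight P ha hσ).const_add _)).const_mul _).div
    ((hS.sigmaBar P ha hσ).pow_const 2)

lemma MeasurableStats.update (P : Params) (hS : MeasurableStats S) (ha : Measurable a)
    (hr : Measurable r) (hσ : Measurable σ) :
    MeasurableStats fun ω => (S ω).update P (a ω) (r ω) (σ ω) := by
  have hs := (hS.sigmaBar P ha hσ).pow_const 2
  have hc : ∀ i, Measurable fun ω => (a ω).ofLp i :=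
    fun i => (PiLp.continuous_apply 2 (fun _ : Fin d => ℝ) i).measurable.comp ha
  constructor
  · intro i j
    simp only [Stats.update, Matrix.add_apply, Matrix.smul_apply, Matrix.vecMulVec_apply,
      smul_eq_mul]
    exact (hS.cov i j).add ((hs.const_div 1).mul ((hc i).mul (hc j)))
  · exact hS.b.add ((hr.div hs).smul ha)

lemma measurableStats_stats (P : Params) {a : ℕ → Ω → Vec d} {r σ : ℕ → Ω → ℝ} {k : ℕ}
    (ha : ∀ t ∈ Finset.Ico 1 k, Measurable (a t)) (hr : ∀ t ∈ Finset.Ico 1 k, Measurable (r t))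
    (hσ : ∀ t ∈ Finset.Ico 1 k, Measurable (σ t)) :
    MeasurableStats fun ω => stats P (fun t => a t ω) (fun t => r t ω) (fun t => σ t ω) k := by
  have hinit : MeasurableStats fun _ : Ω => Stats.init d P :=
    ⟨fun _ _ => measurable_const, measurable_const⟩
  induction k with
  | zero => exact hinit
  | succ k ih =>
    by_cases h : P.IsRestart (k + 1)
    · simp only [stats_restart P _ _ _ h]; exact hinit
    · have hk := Params.ne_zero_of_not_isRestart h
      have hsub : ∀ t ∈ Finset.Ico 1 k, t ∈ Finset.Ico 1 (k + 1) := fun t ht => by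
        rw [Finset.mem_Ico] at ht ⊢; omega
      have hmem : k ∈ Finset.Ico 1 (k + 1) := by rw [Finset.mem_Ico]; omega
      simp only [stats_update P _ _ _ h]
      exact (ih (fun t ht => ha t (hsub t ht)) (fun t ht => hr t (hsub t ht))
        (fun t ht => hσ t (hsub t ht))).update P (ha k hmem) (hr k hmem) (hσ k hmem)

end Measurability

/-! ### Self-normalized concentration of the noise -/

section Concentration

variable {d : ℕ} {Ω : Type*}

lemma history_mono (a : ℕ → Ω → Vec d) (ε : ℕ → Ω → ℝ) {k l : ℕ} (h : k ≤ l) :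
    history a ε k ≤ history a ε l :=
  sup_le_sup (biSup_mono fun _ ht => ⟨ht.1, ht.2.trans h⟩)
    (biSup_mono fun _ ht => ⟨ht.1, ht.2.trans_le h⟩)

lemma measurable_arm_history (a : ℕ → Ω → Vec d) (ε : ℕ → Ω → ℝ) {k t : ℕ}
    (h : t ∈ Set.Icc 1 k) : Measurable[history a ε k] (a t) := by
  rw [measurable_iff_comap_le]
  exact (le_iSup₂ (f := fun t (_ : t ∈ Set.Icc 1 k) => MeasurableSpace.comap (a t) inferInstance)
    t h).trans le_sup_left

lemma measurable_noise_history (a : ℕ → Ω → Vec d) (ε : ℕ → Ω → ℝ) {k t : ℕ}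
    (h : t ∈ Set.Ico 1 k) : Measurable[history a ε k] (ε t) := by
  rw [measurable_iff_comap_le]
  exact (le_iSup₂ (f := fun t (_ : t ∈ Set.Ico 1 k) => MeasurableSpace.comap (ε t) inferInstance)
    t h).trans le_sup_right

variable [mΩ : MeasurableSpace Ω]

/-- The conditional standard deviation of the noise given the history. -/
def condSd (μ : Measure Ω) (a : ℕ → Ω → Vec d) (ε : ℕ → Ω → ℝ) (k : ℕ) (ω : Ω) : ℝ :=
  Real.sqrt ((μ[fun ω => ε k ω ^ 2 | history a ε k]) ω)

lemma measurable_condSd (μ : Measure Ω) (a : ℕ → Ω → Vec d) (ε : ℕ → Ω → ℝ) {k l : ℕ}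
    (h : k ≤ l) : Measurable[history a ε l] (condSd μ a ε k) := by
  have h1 : Measurable[history a ε k] (condSd μ a ε k) :=
    stronglyMeasurable_condExp.measurable.sqrt
  exact h1.mono (history_mono a ε h) le_rfl

/-- The statistics of the noise alone, weighted with the conditional standard deviations. -/
def noiseStats (μ : Measure Ω) (P : Params) (a : ℕ → Ω → Vec d) (ε : ℕ → Ω → ℝ) (k : ℕ) (ω : Ω) :
    Stats d :=
  stats P (fun t => a t ω) (fun t => ε t ω) (fun t => condSd μ a ε t ω) k

lemma measurableStats_noiseStats (μ : Measure Ω) (P : Params) (a : ℕ → Ω → Vec d)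
    (ε : ℕ → Ω → ℝ) (k : ℕ) :
    @MeasurableStats d Ω (history a ε k) (noiseStats μ P a ε k) := by
  refine @measurableStats_stats d Ω (history a ε k) P a ε (condSd μ a ε) k ?_ ?_ ?_
  · exact fun t ht => measurable_arm_history a ε (by
      rw [Finset.mem_Ico] at ht; exact ⟨ht.1, ht.2.le⟩)
  · exact fun t ht => measurable_noise_history a ε (by
      rw [Finset.mem_Ico] at ht; exact ⟨ht.1, ht.2⟩)
  · exact fun t ht => measurable_condSd μ a ε (by rw [Finset.mem_Ico] at ht; omega)

variable {μ : Measure Ω} {K : ℕ} {A B R BK VK : ℝ}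
  {D : ℕ → Ω → Set (Vec d)} {θ : ℕ → Vec d} {a : ℕ → Ω → Vec d} {ε σ : ℕ → Ω → ℝ}

lemma IsBandit.history_le (hb : IsBandit μ K A B R BK VK D θ a ε σ) {k : ℕ} (hk : k ≤ K) :
    history a ε k ≤ mΩ := by
  refine sup_le (iSup₂_le fun t ht => ?_) (iSup₂_le fun t ht => ?_)
  · exact (hb.measurable_arm t (Finset.mem_Icc.2 ⟨ht.1, ht.2.trans hk⟩)).comap_le
  · exact (hb.measurable_noise t (Finset.mem_Icc.2 ⟨ht.1, ht.2.le.trans hk⟩)).comap_le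

/-- `σ k` itself is not assumed measurable. The version `condSd` is measurable for the history, so
the probabilistic arguments are run with it and transferred back almost surely. -/
lemma IsBandit.sd_ae_eq (hb : IsBandit μ K A B R BK VK D θ a ε σ) {k : ℕ}
    (hk : k ∈ Finset.Icc 1 K) : ∀ᵐ ω ∂μ, σ k ω = condSd μ a ε k ω := by
  filter_upwards [hb.noise_variance k hk] with ω hω
  rw [condSd, hω, Real.sqrt_sq (hb.sd_nonneg k hk ω)]

lemma IsBandit.integrable_condSd_sq (hb : IsBandit μ K A B R BK VK D θ a ε σ) {k : ℕ}
    (hk : k ∈ Finset.Icc 1 K) : Integrable (fun ω => condSd μ a ε k ω ^ 2) μ := by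
  refine (integrable_condExp (μ := μ) (m := history a ε k)
    (f := fun ω => ε k ω ^ 2)).congr ?_
  filter_upwards [hb.noise_variance k hk] with ω hω
  rw [condSd, Real.sq_sqrt]
  rw [hω]; positivity

variable [IsProbabilityMeasure μ]

lemma integral_mul_eq_integral_mul_condExp {m : MeasurableSpace Ω} (hm : m ≤ mΩ) {G X : Ω → ℝ}
    (hG : Measurable[m] G) {C : ℝ} (hGC : ∀ᵐ ω ∂μ, |G ω| ≤ C) (hX : Integrable X μ) :
    ∫ ω, G ω * X ω ∂μ = ∫ ω, G ω * (μ[X | m]) ω ∂μ := by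
  have hGX : Integrable (G * X) μ :=
    hX.bdd_mul (hG.mono hm le_rfl).aestronglyMeasurable hGC
  have h := condExp_mul_of_stronglyMeasurable_left (m := m) hG.stronglyMeasurable hGX hX
  calc ∫ ω, G ω * X ω ∂μ = ∫ ω, (μ[G * X | m]) ω ∂μ := (integral_condExp hm).symm
    _ = _ := integral_congr_ae h

lemma IsBandit.integrable_noise (hb : IsBandit μ K A B R BK VK D θ a ε σ) {k : ℕ}
    (hk : k ∈ Finset.Icc 1 K) : Integrable (ε k) μ :=
  Integrable.of_bound (hb.measurable_noise k hk).aestronglyMeasurable R (hb.noise_bounded k hk)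

lemma IsBandit.integrable_noise_sq (hb : IsBandit μ K A B R BK VK D θ a ε σ) {k : ℕ}
    (hk : k ∈ Finset.Icc 1 K) : Integrable (fun ω => ε k ω ^ 2) μ := by
  refine Integrable.of_bound ((hb.measurable_noise k hk).pow_const 2).aestronglyMeasurable
    (R ^ 2) ?_
  filter_upwards [hb.noise_bounded k hk] with ω hω
  rw [Real.norm_eq_abs, abs_pow]
  gcongr

lemma IsBandit.integral_mul_noise (hb : IsBandit μ K A B R BK VK D θ a ε σ) {k : ℕ}
    (hk : k ∈ Finset.Icc 1 K) {G : Ω → ℝ} (hG : Measurable[history a ε k] G) {C : ℝ}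
    (hGC : ∀ᵐ ω ∂μ, |G ω| ≤ C) : ∫ ω, G ω * ε k ω ∂μ = 0 := by
  rw [integral_mul_eq_integral_mul_condExp (hb.history_le (Finset.mem_Icc.1 hk).2) hG hGC
    (hb.integrable_noise hk), integral_eq_zero_of_ae]
  filter_upwards [hb.noise_mean k hk] with ω hω
  rw [hω]; simp

lemma IsBandit.integral_mul_noise_sq (hb : IsBandit μ K A B R BK VK D θ a ε σ) {k : ℕ}
    (hk : k ∈ Finset.Icc 1 K) {G : Ω → ℝ} (hG : Measurable[history a ε k] G) {C : ℝ}
    (hGC : ∀ᵐ ω ∂μ, |G ω| ≤ C) :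
    ∫ ω, G ω * ε k ω ^ 2 ∂μ = ∫ ω, G ω * condSd μ a ε k ω ^ 2 ∂μ := by
  rw [integral_mul_eq_integral_mul_condExp (hb.history_le (Finset.mem_Icc.1 hk).2) hG hGC
    (hb.integrable_noise_sq hk)]
  refine integral_congr_ae ?_
  filter_upwards [hb.noise_variance k hk] with ω hω
  rw [condSd, Real.sq_sqrt]
  rw [hω]; positivity

/-- The exponential potential of the noise is bounded and has expectation at most its initial
value. -/
lemma IsBandit.integral_expPotential_le (hb : IsBandit μ K A B R BK VK D θ a ε σ) {P : Params}
    (hPR : P.R = R) (hl : 0 < P.lam) (hα : 0 < P.α) (hγ : 0 < P.γ) {ρ s κ : ℝ}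
    (hρ : P.R / P.γ ^ 2 ≤ ρ) (hρ0 : 0 < ρ) (hs : 0 < s) (hsb : s * (3 / 2 * (P.R / P.γ ^ 2)) ≤ 1)
    (hκ : κ = s / (2 * ρ) + 5 / 2 * s ^ 2) {k : ℕ} (hk : k ≤ K) :
    (∃ C, ∀ᵐ ω ∂μ, (noiseStats μ P a ε k ω).expPotential P ρ s κ ≤ C) ∧
      ∫ ω, (noiseStats μ P a ε k ω).expPotential P ρ s κ ∂μ ≤ Real.exp (s * ρ) := by
  have hinit : (Stats.init d P).expPotential P ρ s κ = Real.exp (s * ρ) := by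
    rw [Stats.expPotential, potential_init, logDet_init hl]
    simp [Real.sqrt_sq hρ0.le]
  have hκ0 : 0 ≤ κ := by rw [hκ]; positivity
  induction k with
  | zero =>
    have : ∀ ω, (noiseStats μ P a ε 0 ω).expPotential P ρ s κ = Real.exp (s * ρ) := fun _ => hinit
    simp only [this]
    exact ⟨⟨_, Filter.Eventually.of_forall fun _ => le_rfl⟩, by simp⟩
  | succ k ih =>
    -- A restart resets the process to its deterministic initial value, so the bound on the
    -- expectation survives across windows.
    by_cases h : P.IsRestart (k + 1)
    · have : ∀ ω, (noiseStats μ P a ε (k + 1) ω).expPotential P ρ s κ = Real.exp (s * ρ) := by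
        intro ω
        rw [noiseStats, stats_restart P _ _ _ h, hinit]
      simp only [this]
      exact ⟨⟨_, Filter.Eventually.of_forall fun _ => le_rfl⟩, by simp⟩
    have hk0 := Params.ne_zero_of_not_isRestart h
    have hkK : k ∈ Finset.Icc 1 K := Finset.mem_Icc.2 ⟨by omega, by omega⟩
    obtain ⟨⟨C, hC⟩, hint⟩ := ih (by omega)
    have hle := hb.history_le (Finset.mem_Icc.1 hkK).2
    set S := noiseStats μ P a ε k with hSdef
    have hreg : ∀ ω, (S ω).Regular P := fun ω => stats_regular hl _ _ _ k
    have hupd : ∀ ω, noiseStats μ P a ε (k + 1) ω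
        = (S ω).update P (a k ω) (ε k ω) (condSd μ a ε k ω) := fun ω => by
      rw [noiseStats, stats_update P _ _ _ h]; rfl
    have hstep : ∀ᵐ ω ∂μ, _ := (hb.noise_bounded k hkK).mono fun ω hω =>
      expPotential_update_le hl hα hγ (hreg ω) (a k ω) (σ := condSd μ a ε k ω)
        (by rw [hPR]; exact hω) hρ hρ0 hs hsb hκ
    have hSm : @MeasurableStats d Ω (history a ε k) S := measurableStats_noiseStats μ P a ε k
    have ham : Measurable[history a ε k] (a k) :=
      measurable_arm_history a ε ⟨by omega, le_rfl⟩
    have hσm : Measurable[history a ε k] (condSd μ a ε k) := measurable_condSd μ a ε le_rfl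
    set F : Ω → ℝ := fun ω => (S ω).expPotential P ρ s κ with hF
    set E : Ω → ℝ := fun ω =>
      Real.exp (-(κ * Real.log (1 + (S ω).weight P (a k ω) (condSd μ a ε k ω)))) with hE
    set c₁ : Ω → ℝ := fun ω => (S ω).linCoeff P ρ s (a k ω) (condSd μ a ε k ω) with hc1
    set c₂ : Ω → ℝ := fun ω => (S ω).quadCoeff P κ (a k ω) (condSd μ a ε k ω) with hc2
    have hFm : Measurable[history a ε k] F := hSm.expPotential P ρ s κ
    have hEm : Measurable[history a ε k] E :=
      ((((hSm.weight P ham hσm).const_add 1).log).const_mul κ).neg.exp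
    have hc1m : Measurable[history a ε k] c₁ := hSm.linCoeff P ρ s ham hσm
    have hc2m : Measurable[history a ε k] c₂ := hSm.quadCoeff P κ ham hσm
    have hF0 : ∀ ω, 0 < F ω := fun ω => Real.exp_pos _
    have hE0 : ∀ ω, 0 < E ω := fun ω => Real.exp_pos _
    have hE1 : ∀ ω, E ω ≤ 1 := fun ω => by
      have hw := (hreg ω).weight_nonneg (a k ω) (condSd μ a ε k ω)
      have := Real.log_nonneg (x := 1 + (S ω).weight P (a k ω) (condSd μ a ε k ω)) (by linarith)
      exact Real.exp_le_one_iff.2 (by nlinarith)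
    have hc1b : ∀ ω, |c₁ ω| ≤ s / P.α := fun ω => abs_linCoeff_le hα (hreg ω) _ hρ0 hs
    have hc20 : ∀ ω, 0 ≤ c₂ ω := fun ω => quadCoeff_nonneg (hreg ω) _ hκ0
    have hc2b : ∀ ω, c₂ ω ≤ κ / P.α ^ 2 := fun ω => quadCoeff_le hα (hreg ω) _ hκ0
    have hFEC : ∀ᵐ ω ∂μ, |F ω * E ω| ≤ C := hC.mono fun ω hω => by
      rw [abs_of_pos (mul_pos (hF0 ω) (hE0 ω))]
      exact (mul_le_of_le_one_right (hF0 ω).le (hE1 ω)).trans hω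
    have hG1 : ∀ᵐ ω ∂μ, |F ω * E ω * c₁ ω| ≤ C * (s / P.α) := hFEC.mono fun ω hω => by
      rw [abs_mul]
      have := (abs_nonneg _).trans hω
      gcongr
      exact hc1b ω
    have hG2 : ∀ᵐ ω ∂μ, |F ω * E ω * c₂ ω| ≤ C * (κ / P.α ^ 2) := hFEC.mono fun ω hω => by
      rw [abs_mul, abs_of_nonneg (hc20 ω)]
      have := (abs_nonneg _).trans hω
      have := hc20 ω
      gcongr
      exact hc2b ω
    have hFint : Integrable F μ :=
      Integrable.of_bound (hFm.mono hle le_rfl).aestronglyMeasurable C (hC.mono fun ω hω => by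
        rw [Real.norm_eq_abs, abs_of_pos (hF0 ω)]; exact hω)
    have hFEm : Measurable[history a ε k] fun ω => F ω * E ω := hFm.mul hEm
    have hFEint : Integrable (fun ω => F ω * E ω) μ :=
      Integrable.of_bound (hFEm.mono hle le_rfl).aestronglyMeasurable C hFEC
    have hG1m : Measurable[history a ε k] fun ω => F ω * E ω * c₁ ω := hFEm.mul hc1m
    have hG2m : Measurable[history a ε k] fun ω => F ω * E ω * c₂ ω := hFEm.mul hc2m
    have hI1 : Integrable (fun ω => F ω * E ω * c₁ ω * ε k ω) μ :=
      (hb.integrable_noise hkK).bdd_mul (hG1m.mono hle le_rfl).aestronglyMeasurable hG1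
    have hI2 : Integrable (fun ω => F ω * E ω * c₂ ω * ε k ω ^ 2) μ :=
      (hb.integrable_noise_sq hkK).bdd_mul (hG2m.mono hle le_rfl).aestronglyMeasurable hG2
    have hI3 : Integrable (fun ω => F ω * E ω * c₂ ω * condSd μ a ε k ω ^ 2) μ :=
      (hb.integrable_condSd_sq hkK).bdd_mul (hG2m.mono hle le_rfl).aestronglyMeasurable hG2
    simp only [hupd]
    refine ⟨⟨C * Real.exp 1, ?_⟩, ?_⟩
    · filter_upwards [hstep, hC] with ω h1 h2
      exact h1.1.trans (by gcongr)
    calc ∫ ω, ((S ω).update P (a k ω) (ε k ω) (condSd μ a ε k ω)).expPotential P ρ s κ ∂μ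
        ≤ ∫ ω, (F ω * E ω + F ω * E ω * c₁ ω * ε k ω + F ω * E ω * c₂ ω * ε k ω ^ 2) ∂μ := by
          refine integral_mono_of_nonneg
            (Filter.Eventually.of_forall fun ω => (Real.exp_pos _).le)
            ((hFEint.add hI1).add hI2) ?_
          filter_upwards [hstep] with ω h1
          refine h1.2.trans (le_of_eq ?_)
          simp only [hF, hE, hc1, hc2]
          ring
      -- All coefficients are bounded almost surely and measurable for the history, which contains
      -- `a k` but not `ε k`: the linear term integrates to zero and `ε k ^ 2` becomes the
      -- conditional variance.
      _ = ∫ ω, F ω * E ω ∂μ + ∫ ω, F ω * E ω * c₂ ω * condSd μ a ε k ω ^ 2 ∂μ := by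
          have e1 := integral_add (hFEint.add hI1) hI2
          have e2 := integral_add hFEint hI1
          simp only [Pi.add_apply] at e1 e2
          rw [e1, e2, hb.integral_mul_noise hkK hG1m hG1, hb.integral_mul_noise_sq hkK hG2m hG2,
            add_zero]
      _ = ∫ ω, (F ω * E ω + F ω * E ω * c₂ ω * condSd μ a ε k ω ^ 2) ∂μ :=
          (integral_add hFEint hI3).symm
      _ ≤ ∫ ω, F ω ∂μ := by
          refine integral_mono (hFEint.add hI3) hFint fun ω => ?_
          have h1 := exp_neg_mul_one_add_quadCoeff_le hα (hreg ω) (a k ω)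
            (σ := condSd μ a ε k ω) hκ0 (Real.sqrt_nonneg _)
          calc F ω * E ω + F ω * E ω * c₂ ω * condSd μ a ε k ω ^ 2
              = F ω * (E ω * (1 + c₂ ω * condSd μ a ε k ω ^ 2)) := by ring
            _ ≤ F ω := mul_le_of_le_one_right (hF0 ω).le h1
      _ ≤ _ := hint

/-- Choice of parameters in the Chernoff argument, with `J` bounding `log det`, `l` the
log-confidence and `b = R / γ²`. The choice `s = 1 / (3b/2 + √(J/l))` interpolates between the
Gaussian optimum `√(l/J)` and the largest admissible slope `2/(3b)`, and `ρ = √J + b` makes `J / ρ ≤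
√J`. The constants 12 and 30 leave room to spare. -/
lemma exponent_le {J l b : ℝ} (hJ : 0 < J) (hl : 1 ≤ l) (hb : 0 < b) :
    ∃ ρ s κ : ℝ, b ≤ ρ ∧ 0 < ρ ∧ 0 < s ∧ s * (3 / 2 * b) ≤ 1 ∧ 0 ≤ κ ∧
      κ = s / (2 * ρ) + 5 / 2 * s ^ 2 ∧
      s * ρ + κ * J - s * (12 * Real.sqrt (J * l) + 30 * l * b) ≤ -l := by
  obtain ⟨u, hu, rfl⟩ : ∃ u : ℝ, 0 < u ∧ u ^ 2 = J :=
    ⟨Real.sqrt J, Real.sqrt_pos.2 hJ, Real.sq_sqrt hJ.le⟩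
  obtain ⟨v, hv, rfl⟩ : ∃ v : ℝ, 1 ≤ v ∧ v ^ 2 = l :=
    ⟨Real.sqrt l, Real.one_le_sqrt.2 hl, Real.sq_sqrt (by linarith)⟩
  have hv0 : 0 < v := by linarith
  have hsq : Real.sqrt (u ^ 2 * v ^ 2) = u * v := by
    rw [← mul_pow]; exact Real.sqrt_sq (by positivity)
  rw [hsq]
  set D := 3 / 2 * b + u / v with hD
  have hD0 : 0 < D := by positivity
  have hs0 : 0 < 1 / D := by positivity
  refine ⟨u + b, 1 / D, _, by linarith, by positivity, hs0, ?_, ?_, rfl, ?_⟩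
  · rw [one_div_mul_eq_div, div_le_one hD0, hD]
    have : 0 < u / v := by positivity
    linarith
  · positivity
  · have h1 : u ^ 2 / (2 * (u + b)) ≤ u / 2 := by
      rw [div_le_div_iff₀ (by positivity) (by norm_num)]; nlinarith [mul_pos hu hb]
    have h2 : u ^ 2 / D ≤ u * v := by
      rw [div_le_iff₀ hD0, hD]
      have : u * v * (3 / 2 * b + u / v) = u * v * (3 / 2 * b) + u ^ 2 := by field_simp
      rw [this]
      have : 0 < u * v * (3 / 2 * b) := by positivity
      linarith
    have h3 : v ^ 2 * D = 3 / 2 * b * v ^ 2 + u * v := by rw [hD]; field_simp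
    have e : 1 / D * (u + b) + (1 / D / (2 * (u + b)) + 5 / 2 * (1 / D) ^ 2) * u ^ 2
        - 1 / D * (12 * (u * v) + 30 * v ^ 2 * b) + v ^ 2
        = 1 / D * ((u + b) + u ^ 2 / (2 * (u + b)) + 5 / 2 * (u ^ 2 / D)
          - (12 * (u * v) + 30 * v ^ 2 * b) + v ^ 2 * D) := by
      field_simp
      ring
    have h4 : (u + b) + u ^ 2 / (2 * (u + b)) + 5 / 2 * (u ^ 2 / D)
          - (12 * (u * v) + 30 * v ^ 2 * b) + v ^ 2 * D ≤ 0 := by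
      rw [h3]
      nlinarith [mul_nonneg hu.le (sub_nonneg.2 hv), mul_nonneg hb.le (sub_nonneg.2 hv),
        mul_nonneg (mul_nonneg hb.le hv0.le) (sub_nonneg.2 hv)]
    have h5 := mul_nonpos_of_nonneg_of_nonpos hs0.le h4
    linarith [e]

/-- The self-normalized Bernstein inequality at a fixed time. -/
theorem IsBandit.measureReal_potential_gt_le (hb : IsBandit μ K A B R BK VK D θ a ε σ)
    {P : Params} (hPR : P.R = R) (hR : 0 < R) (hl : 0 < P.lam) (hα : 0 < P.α) (hγ : 0 < P.γ)
    {k : ℕ} (hk : k ≤ K) {J l : ℝ} (hJ : 0 < J) (hl1 : 1 ≤ l)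
    (hdet : ∀ ω, (noiseStats μ P a ε k ω).logDet P ≤ J) :
    μ.real {ω | 12 * Real.sqrt (J * l) + 30 * l * (P.R / P.γ ^ 2)
      < Real.sqrt (noiseStats μ P a ε k ω).potential} ≤ Real.exp (-l) := by
  have hRg : 0 < P.R / P.γ ^ 2 := by rw [hPR]; positivity
  obtain ⟨ρ, s, κ, h1, h2, h3, h4, h5, h6, h7⟩ := exponent_le hJ hl1 hRg
  obtain ⟨⟨C, hC⟩, hint⟩ := hb.integral_expPotential_le hPR hl hα hγ h1 h2 h3 h4 h6 hk
  set T := 12 * Real.sqrt (J * l) + 30 * l * (P.R / P.γ ^ 2) with hT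
  have hmeas : Measurable fun ω => (noiseStats μ P a ε k ω).expPotential P ρ s κ :=
    (@MeasurableStats.expPotential d Ω (history a ε k) _ P ρ s κ
      (measurableStats_noiseStats μ P a ε k)).mono (hb.history_le hk) le_rfl
  have hFint : Integrable (fun ω => (noiseStats μ P a ε k ω).expPotential P ρ s κ) μ :=
    Integrable.of_bound hmeas.aestronglyMeasurable C (hC.mono fun ω hω => by
      rw [Real.norm_eq_abs, Stats.expPotential, abs_of_pos (Real.exp_pos _)]; exact hω)
  have hmk := mul_meas_ge_le_integral_of_nonneg
    (Filter.Eventually.of_forall fun ω => (Real.exp_pos _).le) hFint (Real.exp (s * T - κ * J))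
  have hsub : {ω | T < Real.sqrt (noiseStats μ P a ε k ω).potential}
      ⊆ {ω | Real.exp (s * T - κ * J) ≤ (noiseStats μ P a ε k ω).expPotential P ρ s κ} := by
    intro ω hω
    have h8 : Real.sqrt (noiseStats μ P a ε k ω).potential
        ≤ Real.sqrt (ρ ^ 2 + (noiseStats μ P a ε k ω).potential) :=
      Real.sqrt_le_sqrt (by linarith [sq_nonneg ρ])
    have hω' : T < Real.sqrt (noiseStats μ P a ε k ω).potential := hω
    have h9 := mul_le_mul_of_nonneg_left (hω'.le.trans h8) h3.le
    have h10 := mul_le_mul_of_nonneg_left (hdet ω) h5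
    simp only [Set.mem_ofPred_eq, Stats.expPotential, Real.exp_le_exp]
    linarith
  refine (measureReal_mono hsub).trans ?_
  have h11 := hmk.trans hint
  rw [mul_comm, ← le_div_iff₀ (Real.exp_pos _), ← Real.exp_sub] at h11
  refine h11.trans (Real.exp_le_exp.2 ?_)
  linarith

end Concentration

/-! ### Counting the rounds with an invalid confidence ellipsoid -/

section BadRounds

variable {d : ℕ}

lemma stats_congr_sd (P : Params) (a : ℕ → Vec d) (r : ℕ → ℝ) {σ σ' : ℕ → ℝ} {k : ℕ}
    (h : ∀ t ∈ Finset.Ico 1 k, σ t = σ' t) : stats P a r σ k = stats P a r σ' k := by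
  induction k with
  | zero => rfl
  | succ k ih =>
    by_cases hr : P.IsRestart (k + 1)
    · rw [stats_restart P a r σ hr, stats_restart P a r σ' hr]
    · have hk := Params.ne_zero_of_not_isRestart hr
      rw [stats_update P a r σ hr, stats_update P a r σ' hr,
        ih fun t ht => h t (by rw [Finset.mem_Ico] at ht ⊢; omega),
        h k (by rw [Finset.mem_Ico]; omega)]

lemma sum_inv_mod_sq_le {w : ℕ} (hw : 1 ≤ w) (K : ℕ) :
    ∑ k ∈ Finset.Icc 1 K, (((k % w : ℕ) : ℝ) ^ 2)⁻¹ ≤ ((K / w : ℕ) + 1) * 2 := by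
  have hblock : ∑ m ∈ Finset.range w, ((m : ℝ) ^ 2)⁻¹ ≤ 2 := by
    have h := sum_Ioo_inv_sq_le (α := ℝ) 0 w
    simp only [Nat.cast_zero, zero_add, div_one] at h
    refine le_trans (le_of_eq ?_) h
    symm
    refine Finset.sum_subset (fun i hi => ?_) (fun i hi hi' => ?_)
    · simp only [Finset.mem_Ioo, Finset.mem_range] at hi ⊢; omega
    · simp only [Finset.mem_Ioo, Finset.mem_range] at hi hi'
      -- Position 0, a restart, contributes nothing because `(0 ^ 2)⁻¹ = 0`.
      have : i = 0 := by omega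
      simp [this]
  have hsum : ∀ N : ℕ, ∑ k ∈ Finset.range (N * w), (((k % w : ℕ) : ℝ) ^ 2)⁻¹ ≤ N * 2 := by
    intro N
    induction N with
    | zero => simp
    | succ N ih =>
      rw [Nat.succ_mul, Finset.sum_range_add]
      have : ∑ m ∈ Finset.range w, ((((N * w + m) % w : ℕ) : ℝ) ^ 2)⁻¹
          = ∑ m ∈ Finset.range w, ((m : ℝ) ^ 2)⁻¹ := by
        refine Finset.sum_congr rfl fun m hm => ?_
        rw [Nat.add_comm, Nat.add_mul_mod_self_right, Nat.mod_eq_of_lt (Finset.mem_range.1 hm)]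
      rw [this]
      push_cast
      linarith
  refine le_trans (Finset.sum_le_sum_of_subset_of_nonneg (t := Finset.range ((K / w + 1) * w))
    (fun k hk => ?_) (fun _ _ _ => by positivity)) ?_
  · rw [Finset.mem_Icc] at hk
    rw [Finset.mem_range, Nat.succ_mul]
    have := Nat.div_add_mod' K w
    have := Nat.mod_lt K hw
    omega
  · exact_mod_cast hsum (K / w + 1)

lemma one_le_logFactor {P : Params} (hδ0 : 0 < P.δ) (hδ1 : P.δ < 1) {m : ℕ} (hm : 1 ≤ m) :
    1 ≤ logFactor P m := by
  have h1 : (1 : ℝ) ≤ m := by exact_mod_cast hm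
  have h2 := Real.posLog_nonneg (x := P.γ ^ 2 / P.α)
  rw [logFactor, Real.le_log_iff_exp_le (by positivity)]
  refine Real.exp_one_lt_d9.le.trans ?_
  rw [le_div_iff₀ hδ0]
  have h3 : (1 : ℝ) ≤ (m : ℝ) ^ 2 := one_le_pow₀ h1
  have h4 : (1 : ℝ) ≤ (Real.posLog (P.γ ^ 2 / P.α) + 1) * (m : ℝ) ^ 2 := by nlinarith
  nlinarith

lemma exp_neg_logFactor_le {P : Params} (hδ0 : 0 < P.δ) {m : ℕ} (hm : 1 ≤ m) :
    Real.exp (-logFactor P m) ≤ P.δ / 32 * ((m : ℝ) ^ 2)⁻¹ := by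
  have h1 : (0 : ℝ) < m := by exact_mod_cast hm
  have h2 := Real.posLog_nonneg (x := P.γ ^ 2 / P.α)
  rw [logFactor, Real.exp_neg, Real.exp_log (by positivity), inv_div,
    show P.δ / 32 * ((m : ℝ) ^ 2)⁻¹ = P.δ / (32 * 1 * (m : ℝ) ^ 2) by field_simp]
  gcongr
  linarith

variable {Ω : Type*} [mΩ : MeasurableSpace Ω] {μ : Measure Ω} [IsProbabilityMeasure μ] {K : ℕ}
  {A B R BK VK : ℝ} {D : ℕ → Ω → Set (Vec d)} {θ : ℕ → Vec d} {a : ℕ → Ω → Vec d}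
  {ε σ : ℕ → Ω → ℝ}

lemma IsBandit.measureReal_isBad_le (hb : IsBandit μ K A B R BK VK D θ a ε σ)
    {P : Params} (hPR : P.R = R) (hPA : P.A = A) (hR : 0 < R) (hA : 0 < A) (hd : 1 ≤ d)
    (hl : 0 < P.lam) (hα : 0 < P.α) (hγ : 0 < P.γ) (hδ0 : 0 < P.δ) (hδ1 : P.δ < 1)
    (ha : ∀ k ∈ Finset.Icc 1 K, ∀ ω, ‖a k ω‖ ≤ A) {k : ℕ} (hk : k ∈ Finset.Icc 1 K) :
    μ.real {ω | IsBad d P (fun t => a t ω) (fun t => ε t ω) (fun t => condSd μ a ε t ω) k}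
      ≤ P.δ / 32 * (((k % P.w : ℕ) : ℝ) ^ 2)⁻¹ := by
  have hd0 : (0 : ℝ) < d := by exact_mod_cast hd
  rw [Finset.mem_Icc] at hk
  by_cases hr : P.IsRestart k
  · have : {ω | IsBad d P (fun t => a t ω) (fun t => ε t ω) (fun t => condSd μ a ε t ω) k} = ∅ := by
      ext ω; simp [IsBad, hr]
    rw [this]
    simp only [measureReal_empty]
    positivity
  have hm : 1 ≤ k % P.w := by
    by_contra h0
    exact hr (Or.inr (by omega))
  have hm0 : (0 : ℝ) < (k % P.w : ℕ) := by exact_mod_cast hm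
  set J := d * Real.log (1 + ((k % P.w : ℕ) : ℝ) * P.A ^ 2 / (P.α ^ 2 * d * P.lam)) with hJ
  have hPA0 : 0 < P.A := by rw [hPA]; exact hA
  have hJ0 : 0 < J := by
    refine mul_pos hd0 (Real.log_pos ?_)
    have : 0 < ((k % P.w : ℕ) : ℝ) * P.A ^ 2 / (P.α ^ 2 * d * P.lam) := by positivity
    linarith
  have hdet : ∀ ω, (noiseStats μ P a ε k ω).logDet P ≤ J := by
    intro ω
    refine ((stats_regular hl _ _ _ k).logDet_le hl hd (trace_stats_le hα _ _
      (fun t ht => ha t ht ω) (by omega : k ≤ K + 1))).trans (le_of_eq ?_)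
    rw [hJ, hPA]
    congr 3
    field_simp
  have h := hb.measureReal_potential_gt_le hPR hR hl hα hγ hk.2 hJ0
    (one_le_logFactor hδ0 hδ1 hm) hdet
  refine le_trans (measureReal_mono ?_) (h.trans (exp_neg_logFactor_le hδ0 hm))
  intro ω hω
  have h2 := hω.2
  have hrad : radius d P k - Real.sqrt P.lam * P.B
      = 12 * Real.sqrt (J * logFactor P (k % P.w))
        + 30 * logFactor P (k % P.w) * (P.R / P.γ ^ 2) := by
    rw [radius, if_neg (show ¬ (k = 1 ∨ k % P.w = 0) from hr), hJ]; ring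
  rw [hrad] at h2
  exact h2

open Classical in
/-- With high probability there is on average at most one bad round in each window. -/
lemma IsBandit.measureReal_card_isBad_gt_le (hb : IsBandit μ K A B R BK VK D θ a ε σ)
    {P : Params} (hPR : P.R = R) (hPA : P.A = A) (hR : 0 < R) (hA : 0 < A) (hd : 1 ≤ d)
    (hw : 1 ≤ P.w) (hl : 0 < P.lam) (hα : 0 < P.α) (hγ : 0 < P.γ) (hδ0 : 0 < P.δ)
    (hδ1 : P.δ < 1) (ha : ∀ k ∈ Finset.Icc 1 K, ∀ ω, ‖a k ω‖ ≤ A) :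
    μ.real {ω | ((K / P.w : ℕ) + 1 : ℝ) < (((Finset.Icc 1 K).filter (IsBad d P (fun t => a t ω)
      (fun t => ε t ω) (fun t => condSd μ a ε t ω))).card : ℝ)} ≤ P.δ := by
  set E : ℕ → Set Ω := fun k =>
    {ω | IsBad d P (fun t => a t ω) (fun t => ε t ω) (fun t => condSd μ a ε t ω) k} with hE
  have hEm : ∀ k ∈ Finset.Icc 1 K, MeasurableSet (E k) := by
    intro k hk
    by_cases hr : P.IsRestart k
    · have : E k = ∅ := by ext ω; simp [hE, IsBad, hr]
      rw [this]; exact MeasurableSet.empty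
    · have hpot : Measurable fun ω => (noiseStats μ P a ε k ω).potential :=
        (@MeasurableStats.potential d Ω (history a ε k) _
          (measurableStats_noiseStats μ P a ε k)).mono
          (hb.history_le (Finset.mem_Icc.1 hk).2) le_rfl
      have : E k = {ω | radius d P k - Real.sqrt P.lam * P.B
          < Real.sqrt (noiseStats μ P a ε k ω).potential} := by
        ext ω; simp only [hE, IsBad, hr, not_false_eq_true, true_and]; rfl
      rw [this]
      exact measurableSet_lt measurable_const hpot.sqrt
  set N : ℝ := (K / P.w : ℕ) + 1 with hN
  have hN0 : 0 < N := by positivity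
  set f : Ω → ℝ := fun ω => ∑ k ∈ Finset.Icc 1 K, (E k).indicator (fun _ => (1 : ℝ)) ω with hf
  have hcard : ∀ ω, (((Finset.Icc 1 K).filter (IsBad d P (fun t => a t ω)
      (fun t => ε t ω) (fun t => condSd μ a ε t ω))).card : ℝ) = f ω := by
    intro ω
    rw [hf, Finset.card_filter]
    push_cast
    refine Finset.sum_congr rfl fun k _ => ?_
    simp only [Set.indicator_apply, hE]
    rfl
  have hi : ∀ k ∈ Finset.Icc 1 K, Integrable ((E k).indicator (fun _ => (1 : ℝ))) μ :=
    fun k hk => (integrable_const 1).indicator (hEm k hk)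
  have hfi : Integrable f μ := integrable_finsetSum _ hi
  -- The expected count scales with the number of windows, and so does the threshold `N`; Markov's
  -- inequality therefore returns `δ` without a union bound over windows.
  have hint : ∫ ω, f ω ∂μ ≤ P.δ * N := by
    rw [hf, integral_finsetSum _ hi]
    calc ∑ k ∈ Finset.Icc 1 K, ∫ ω, (E k).indicator (fun _ => (1 : ℝ)) ω ∂μ
        ≤ ∑ k ∈ Finset.Icc 1 K, P.δ / 32 * (((k % P.w : ℕ) : ℝ) ^ 2)⁻¹ := by
          refine Finset.sum_le_sum fun k hk => ?_
          rw [integral_indicator_const _ (hEm k hk), smul_eq_mul, mul_one]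
          exact hb.measureReal_isBad_le hPR hPA hR hA hd hl hα hγ hδ0 hδ1 ha hk
      _ ≤ P.δ / 32 * (N * 2) := by
          rw [← Finset.mul_sum]
          gcongr
          exact sum_inv_mod_sq_le hw K
      _ ≤ P.δ * N := by nlinarith [mul_pos hδ0 hN0]
  have hmk := mul_meas_ge_le_integral_of_nonneg (Filter.Eventually.of_forall fun ω =>
    Finset.sum_nonneg fun k _ => Set.indicator_nonneg (fun _ _ => zero_le_one) ω) hfi N
  have h1 : μ.real {ω | N ≤ f ω} ≤ P.δ := by
    have := hmk.trans hint
    rw [mul_comm] at this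
    exact le_of_mul_le_mul_right this hN0
  refine (measureReal_mono fun ω hω => ?_).trans h1
  have hω' : N < _ := hω
  rw [hcard] at hω'
  exact hω'.le

end BadRounds

/-! ### Comparison of the tuned parameters with the rate -/

section Rates

/-- The rate of the regret bound. -/
def rate (d K BK VK : ℝ) : ℝ :=
  d ^ (7 / 8 : ℝ) * (BK * VK) ^ (1 / 4 : ℝ) * Real.sqrt K
    + d ^ (5 / 6 : ℝ) * BK ^ (1 / 3 : ℝ) * K ^ (2 / 3 : ℝ)

lemma pow_rpow_eq {x : ℝ} (hx : 0 ≤ x) {m k : ℕ} {r : ℝ} (h : (m : ℝ) * r = k) :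
    (x ^ m) ^ r = x ^ k := by
  rw [← Real.rpow_natCast, ← Real.rpow_mul hx, h, Real.rpow_natCast]

lemma exists_pow_eq {t : ℝ} (ht : 0 < t) {m : ℕ} (hm : m ≠ 0) : ∃ x : ℝ, 0 < x ∧ x ^ m = t :=
  ⟨t ^ ((m : ℝ)⁻¹), Real.rpow_pos_of_pos ht _, Real.rpow_inv_natCast_pow ht.le hm⟩

lemma min_one_le_of_le_pow {t q : ℝ} (ht : 0 ≤ t) {m : ℕ} (hm : 1 ≤ m) (h : q ≤ t ^ m) :
    min 1 q ≤ t := by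
  rcases le_total 1 t with h1 | h1
  · exact (min_le_left _ _).trans h1
  · exact (min_le_right _ _).trans (h.trans (pow_le_of_le_one ht h1 (by omega)))

/-- All the comparisons between the tuned parameters and the rate. -/
lemma tuned_rates {d K n : ℕ} {A B R lam δ BK VK c₁ c₂ : ℝ} (hd : 1 ≤ d) (hK : 1 ≤ K)
    (hc₁ : 0 < c₁) (hc₂ : 0 < c₂) (hBK : BK ∈ Set.Icc c₁ (c₂ * K))
    (hVK : VK ∈ Set.Icc c₁ (c₂ * K)) {w α T : ℝ} (hw : w = targetWindow d K BK VK)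
    (hα : α = (tunedParams d K n A B R lam δ BK VK).α) (hT : T = rate d K BK VK) :
    min 1 c₂⁻¹ ≤ w ∧ 0 < α ∧ 0 < T ∧ c₁ * w ^ 2 ≤ α ^ 2 * d * K ∧ d * K / w ≤ T ∧
      d * Real.sqrt (K * VK) / Real.sqrt w ≤ T ∧ d * K * α / Real.sqrt w ≤ T ∧
      Real.sqrt w * w * BK / α ≤ T ∧
      (K < w → min 1 (min c₁ (c₁ ^ 2 / c₂)) * K ≤ T) := by
  have hd1 : (1 : ℝ) ≤ d := by exact_mod_cast hd
  have hK1 : (1 : ℝ) ≤ K := by exact_mod_cast hK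
  obtain ⟨hB1, hB2⟩ := hBK
  obtain ⟨hV1, hV2⟩ := hVK
  have hB0 : 0 < BK := hc₁.trans_le hB1
  have hV0 : 0 < VK := hc₁.trans_le hV1
  have hα' : α = (d : ℝ) ^ (-(1 / 4) : ℝ) * BK ^ (1 / 2 : ℝ) * w * (K : ℝ) ^ (-(1 / 2) : ℝ) := by
    rw [hα, hw]; rfl
  rw [targetWindow] at hw
  rw [rate] at hT
  generalize (d : ℝ) = d' at *
  generalize (K : ℝ) = K' at *
  -- Writing `d = x²⁴`, `B_K = y¹²`, `K = z⁶`, `V_K = v⁴` turns all fractional powers into integer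
  -- ones, and the regime condition into `z y ≤ x v`.
  obtain ⟨x, hx, rfl⟩ := exists_pow_eq (by linarith : 0 < d') (m := 24) (by norm_num)
  obtain ⟨y, hy, rfl⟩ := exists_pow_eq hB0 (m := 12) (by norm_num)
  obtain ⟨z, hz, rfl⟩ := exists_pow_eq (by linarith : 0 < K') (m := 6) (by norm_num)
  obtain ⟨v, hv, rfl⟩ := exists_pow_eq hV0 (m := 4) (by norm_num)
  have hx1 : 1 ≤ x := by
    by_contra hlt
    exact absurd hd1 (not_le.2 (pow_lt_one₀ hx.le (not_le.1 hlt) (by norm_num)))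
  have e1 : (x ^ 24) ^ (1 / 4 : ℝ) = x ^ 6 := pow_rpow_eq hx.le (by norm_num)
  have e2 : (x ^ 24) ^ (1 / 6 : ℝ) = x ^ 4 := pow_rpow_eq hx.le (by norm_num)
  have e3 : (x ^ 24) ^ (7 / 8 : ℝ) = x ^ 21 := pow_rpow_eq hx.le (by norm_num)
  have e4 : (x ^ 24) ^ (5 / 6 : ℝ) = x ^ 20 := pow_rpow_eq hx.le (by norm_num)
  have e5 : (x ^ 24) ^ (-(1 / 4) : ℝ) = (x ^ 6)⁻¹ := by
    rw [Real.rpow_neg (by positivity), e1]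
  have e6 : (y ^ 12) ^ (1 / 2 : ℝ) = y ^ 6 := pow_rpow_eq hy.le (by norm_num)
  have e7 : (y ^ 12) ^ (1 / 3 : ℝ) = y ^ 4 := pow_rpow_eq hy.le (by norm_num)
  have e8 : (z ^ 6) ^ (2 / 3 : ℝ) = z ^ 4 := pow_rpow_eq hz.le (by norm_num)
  have e9 : (z ^ 6) ^ (1 / 2 : ℝ) = z ^ 3 := pow_rpow_eq hz.le (by norm_num)
  have e10 : (z ^ 6) ^ (-(1 / 2) : ℝ) = (z ^ 3)⁻¹ := by
    rw [Real.rpow_neg (by positivity), e9]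
  have e11 : (y ^ 12 * v ^ 4) ^ (1 / 4 : ℝ) = y ^ 3 * v := by
    rw [show y ^ 12 * v ^ 4 = (y ^ 3 * v) ^ 4 by ring,
      pow_rpow_eq (k := 1) (by positivity) (by norm_num), pow_one]
  have e12 : Real.sqrt (z ^ 6) = z ^ 3 := by rw [Real.sqrt_eq_rpow, e9]
  have e13 : Real.sqrt (v ^ 4 / y ^ 12) = v ^ 2 / y ^ 6 := by
    rw [show v ^ 4 / y ^ 12 = (v ^ 2 / y ^ 6) ^ 2 by rw [div_pow]; ring,
      Real.sqrt_sq (by positivity)]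
  have e14 : (z ^ 6 / y ^ 12) ^ (1 / 3 : ℝ) = z ^ 2 / y ^ 4 := by
    rw [show z ^ 6 / y ^ 12 = (z ^ 2 / y ^ 4) ^ 3 by rw [div_pow]; ring,
      pow_rpow_eq (k := 1) (by positivity) (by norm_num), pow_one]
  have e15 : Real.sqrt (z ^ 6 * v ^ 4) = z ^ 3 * v ^ 2 := by
    rw [show z ^ 6 * v ^ 4 = (z ^ 3 * v ^ 2) ^ 2 by ring, Real.sqrt_sq (by positivity)]
  rw [e1, e2, e13, e14] at hw
  rw [e3, e4, e7, e8, e11, e12] at hT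
  rw [e5, e6, e10] at hα'
  rw [e15]
  clear hα
  have hcond : (z ^ 6) ^ 4 * (y ^ 12) ^ 2 ≤ x ^ 24 * (v ^ 4) ^ 6 ↔ z * y ≤ x * v := by
    rw [show (z ^ 6) ^ 4 * (y ^ 12) ^ 2 = (z * y) ^ 24 by ring,
      show x ^ 24 * (v ^ 4) ^ 6 = (x * v) ^ 24 by ring]
    exact pow_le_pow_iff_left₀ (by positivity) (by positivity) (by norm_num)
  simp only [hcond] at hw
  have hT0 : 0 < T := by rw [hT]; positivity
  have hT1 : x ^ 21 * (y ^ 3 * v) * z ^ 3 ≤ T := by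
    rw [hT]; have : 0 < x ^ 20 * y ^ 4 * z ^ 4 := by positivity
    linarith
  have hT2 : x ^ 20 * y ^ 4 * z ^ 4 ≤ T := by
    rw [hT]; have : 0 < x ^ 21 * (y ^ 3 * v) * z ^ 3 := by positivity
    linarith
  obtain ⟨u, hu, hwu, hcase⟩ : ∃ u : ℝ, 0 < u ∧ w = u ^ 2 ∧
      ((z * y ≤ x * v ∧ u = x ^ 3 * v / y ^ 3) ∨ (x * v ≤ z * y ∧ u = x ^ 2 * z / y ^ 2)) := by
    by_cases h : z * y ≤ x * v
    · refine ⟨x ^ 3 * v / y ^ 3, by positivity, ?_, Or.inl ⟨h, rfl⟩⟩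
      rw [hw, if_pos h, div_pow]; ring
    · refine ⟨x ^ 2 * z / y ^ 2, by positivity, ?_, Or.inr ⟨(not_le.1 h).le, rfl⟩⟩
      rw [hw, if_neg h, div_pow]; ring
  have hsu : Real.sqrt w = u := by rw [hwu, Real.sqrt_sq hu.le]
  have hαu : α = y ^ 6 * u ^ 2 / (x ^ 6 * z ^ 3) := by
    rw [hα', hwu]; field_simp
  have hα0 : 0 < α := by rw [hαu]; positivity
  -- In both regimes `w` dominates `d^{1/6} (K/B_K)^{1/3}`: the definition by cases is the maximum
  -- of the two expressions.
  have hlow : x ^ 2 * z / y ^ 2 ≤ u := by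
    rcases hcase with ⟨h, rfl⟩ | ⟨h, rfl⟩
    · rw [div_le_div_iff₀ (by positivity) (by positivity)]
      calc x ^ 2 * z * y ^ 3 = x ^ 2 * y ^ 2 * (z * y) := by ring
        _ ≤ x ^ 2 * y ^ 2 * (x * v) := by gcongr
        _ = _ := by ring
    · exact le_rfl
  -- The left side is `d^{3/4} √(B_K K w)`, which equals the cost `dKα/√w` of the floor and exceeds
  -- the drift cost by a factor `√d`; in each regime it matches one summand of the rate.
  have hmid : x ^ 18 * y ^ 6 * z ^ 3 * u ≤ T := by
    rcases hcase with ⟨h, rfl⟩ | ⟨h, rfl⟩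
    · refine le_trans (le_of_eq ?_) hT1
      field_simp
    · refine le_trans (le_of_eq ?_) hT2
      field_simp
  rw [hsu]
  refine ⟨?_, hα0, hT0, ?_, ?_, ?_, ?_, ?_, ?_⟩
  · refine min_one_le_of_le_pow (m := 3) (by rw [hwu]; positivity) (by norm_num) ?_
    have h1 : (x ^ 2 * z / y ^ 2) ^ 6 ≤ u ^ 6 := by gcongr
    have h2 : c₂⁻¹ ≤ (x ^ 2 * z / y ^ 2) ^ 6 := by
      rw [div_pow, inv_eq_one_div, div_le_div_iff₀ hc₂ (by positivity)]
      calc 1 * (y ^ 2) ^ 6 = 1 * y ^ 12 := by ring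
        _ ≤ x ^ 12 * (c₂ * z ^ 6) := by
          gcongr
          exact one_le_pow₀ hx1
        _ = _ := by ring
    rw [hwu]
    linarith [show (u ^ 2) ^ 3 = u ^ 6 by ring]
  · have : α ^ 2 * x ^ 24 * z ^ 6 = x ^ 12 * y ^ 12 * w ^ 2 := by
      rw [hαu, hwu]; field_simp
    rw [this]
    have h12 : 1 ≤ x ^ 12 := one_le_pow₀ hx1
    calc c₁ * w ^ 2 ≤ 1 * y ^ 12 * w ^ 2 := by rw [one_mul]; gcongr
      _ ≤ _ := by gcongr
  · rw [hwu, div_le_iff₀ (by positivity)]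
    have h1 : (x ^ 2 * z / y ^ 2) ^ 2 ≤ u ^ 2 := by gcongr
    calc x ^ 24 * z ^ 6 = x ^ 20 * y ^ 4 * z ^ 4 * (x ^ 2 * z / y ^ 2) ^ 2 := by
          field_simp
      _ ≤ T * u ^ 2 := by gcongr
  · rw [div_le_iff₀ hu]
    rcases hcase with ⟨h, rfl⟩ | ⟨h, rfl⟩
    · calc x ^ 24 * (z ^ 3 * v ^ 2)
          = x ^ 21 * (y ^ 3 * v) * z ^ 3 * (x ^ 3 * v / y ^ 3) := by field_simp
        _ ≤ _ := by gcongr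
    · calc x ^ 24 * (z ^ 3 * v ^ 2) = x ^ 22 * z ^ 3 * (x * v) ^ 2 := by ring
        _ ≤ x ^ 22 * z ^ 3 * (z * y) ^ 2 := by gcongr
        _ = x ^ 20 * y ^ 4 * z ^ 4 * (x ^ 2 * z / y ^ 2) := by field_simp
        _ ≤ _ := by gcongr
  · refine le_trans (le_of_eq ?_) hmid
    rw [hαu]; field_simp
  · refine le_trans ?_ hmid
    rw [hwu, hαu]
    have h12 : 1 ≤ x ^ 12 := one_le_pow₀ hx1
    calc u * u ^ 2 * y ^ 12 / (y ^ 6 * u ^ 2 / (x ^ 6 * z ^ 3))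
        = 1 * (x ^ 6 * y ^ 6 * z ^ 3 * u) := by field_simp
      _ ≤ x ^ 12 * (x ^ 6 * y ^ 6 * z ^ 3 * u) := by gcongr
      _ = _ := by ring
  -- When the window exceeds the horizon, `K < w` forces `B_K` to be small relative to the other
  -- parameters. Together with `B_K ≥ c₁` and, in the first regime, `V_K ≤ c₂ K`, this puts the rate
  -- above a multiple of `K`.
  · intro hKw
    rw [hwu] at hKw
    have h3u : z ^ 3 < u := by
      rw [show z ^ 6 = (z ^ 3) ^ 2 by ring] at hKw
      exact lt_of_pow_lt_pow_left₀ 2 hu.le hKw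
    rw [← le_div_iff₀ (by positivity)]
    rcases hcase with ⟨h, rfl⟩ | ⟨h, rfl⟩
    · have h1 : min 1 (c₁ ^ 2 / c₂) ≤ T / z ^ 6 := by
        refine min_one_le_of_le_pow (m := 3) (by positivity) (by norm_num) ?_
        have h2 : z ^ 3 * y ^ 3 ≤ x ^ 3 * v := by
          rw [lt_div_iff₀ (by positivity)] at h3u; exact h3u.le
        have h4 : z ^ 6 * y ^ 12 ≤ c₂ * x ^ 12 := by
          have : (z ^ 3 * y ^ 3) ^ 4 ≤ (x ^ 3 * v) ^ 4 := by gcongr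
          have h5 : z ^ 6 * (z ^ 6 * y ^ 12) ≤ z ^ 6 * (c₂ * x ^ 12) := by
            calc z ^ 6 * (z ^ 6 * y ^ 12) = (z ^ 3 * y ^ 3) ^ 4 := by ring
              _ ≤ (x ^ 3 * v) ^ 4 := this
              _ = x ^ 12 * v ^ 4 := by ring
              _ ≤ x ^ 12 * (c₂ * z ^ 6) := by gcongr
              _ = _ := by ring
          exact le_of_mul_le_mul_left h5 (by positivity)
        have h6 : (x ^ 20 * y ^ 4 * z ^ 4) ^ 3 ≤ T ^ 3 := by gcongr
        rw [div_pow, div_le_div_iff₀ hc₂ (by positivity)]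
        have h7 : x ^ 12 ≤ x ^ 60 := pow_le_pow_right₀ hx1 (by norm_num)
        calc c₁ ^ 2 * (z ^ 6) ^ 3 ≤ (y ^ 12) ^ 2 * (z ^ 6) ^ 3 := by gcongr
          _ = y ^ 12 * z ^ 12 * (z ^ 6 * y ^ 12) := by ring
          _ ≤ y ^ 12 * z ^ 12 * (c₂ * x ^ 60) :=
            mul_le_mul_of_nonneg_left (h4.trans (by gcongr)) (by positivity)
          _ = (x ^ 20 * y ^ 4 * z ^ 4) ^ 3 * c₂ := by ring
          _ ≤ T ^ 3 * c₂ := by gcongr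
      exact le_trans (min_le_min le_rfl (min_le_right _ _)) h1
    · have h1 : min 1 c₁ ≤ T / z ^ 6 := by
        refine min_one_le_of_le_pow (m := 2) (by positivity) (by norm_num) ?_
        have h2 : z ^ 2 * y ^ 2 ≤ x ^ 2 := by
          rw [lt_div_iff₀ (by positivity)] at h3u
          have : z * (z ^ 2 * y ^ 2) ≤ z * x ^ 2 := by
            linarith [show z * (z ^ 2 * y ^ 2) = z ^ 3 * y ^ 2 by ring]
          exact le_of_mul_le_mul_left this hz
        have h6 : (x ^ 20 * y ^ 4 * z ^ 4) ^ 2 ≤ T ^ 2 := by gcongr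
        have h7 : x ^ 4 ≤ x ^ 40 := pow_le_pow_right₀ hx1 (by norm_num)
        rw [div_pow, le_div_iff₀ (by positivity)]
        calc c₁ * (z ^ 6) ^ 2 ≤ y ^ 12 * (z ^ 6) ^ 2 := by gcongr
          _ = y ^ 8 * z ^ 8 * (z ^ 2 * y ^ 2) ^ 2 := by ring
          _ ≤ y ^ 8 * z ^ 8 * (x ^ 2) ^ 2 := by gcongr
          _ = y ^ 8 * z ^ 8 * x ^ 4 := by ring
          _ ≤ y ^ 8 * z ^ 8 * x ^ 40 := by gcongr
          _ = (x ^ 20 * y ^ 4 * z ^ 4) ^ 2 := by ring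
          _ ≤ T ^ 2 := h6
      exact le_trans (min_le_min le_rfl (min_le_left _ _)) h1

/-- Applied with `s = α² d`. Tuning makes `α² d K` bounded below by a constant `q`, so a small `α`
costs only a power of `K` inside the logarithm. -/
lemma log_one_add_div_le {K s q A lam : ℝ} (hK : 1 ≤ K) (hq : 0 < q) (hlam : 0 < lam)
    (hs : 0 < s) (hqs : q ≤ s * K) {m : ℝ} (hm0 : 0 ≤ m) (hm : m ≤ 2 * K) :
    Real.log (1 + m * A ^ 2 / (s * lam))
      ≤ Real.log (1 + 2 * A ^ 2 / (q * lam)) + 2 * Real.log K := by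
  have hK0 : 0 < K := by linarith
  rw [show 2 * Real.log K = Real.log (K ^ 2) by rw [Real.log_pow]; norm_num,
    ← Real.log_mul (by positivity) (by positivity)]
  apply Real.log_le_log (by positivity)
  have h1 : m * A ^ 2 / (s * lam) ≤ 2 * A ^ 2 / (q * lam) * K ^ 2 := by
    rw [div_mul_eq_mul_div, div_le_div_iff₀ (by positivity) (by positivity)]
    calc m * A ^ 2 * (q * lam) ≤ 2 * K * A ^ 2 * (s * K * lam) := by gcongr
      _ = _ := by ring
  have h2 : 1 ≤ K ^ 2 := one_le_pow₀ hK
  linarith [add_mul 1 (2 * A ^ 2 / (q * lam)) (K ^ 2)]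

lemma logFactor_le {P : Params} {K : ℕ} {R q s : ℝ} (hδ0 : 0 < P.δ) (hq : 0 < q) (hK : 1 ≤ K)
    (hs : 0 < s) (hqs : q ≤ s * K) (hratio : (P.γ ^ 2 / P.α) ^ 2 = R ^ 2 / s) {m : ℕ} (hm : 1 ≤ m)
    (hmK : m ≤ K) :
    logFactor P m ≤ Real.log 32 + Real.posLog (R ^ 2 / q) + 3 * Real.log K + Real.log (1 / P.δ) := by
  have hK0 : (0 : ℝ) < K := by exact_mod_cast hK
  have hm0 : (0 : ℝ) < m := by exact_mod_cast hm
  have hmK' : (m : ℝ) ≤ K := by exact_mod_cast hmK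
  set X := Real.posLog (P.γ ^ 2 / P.α) with hX
  have hX0 : 0 ≤ X := Real.posLog_nonneg
  have hXle : X ≤ Real.posLog (R ^ 2 / q) + Real.log K := by
    -- Squaring the ratio `γ² / α` turns it into `R² / (α² d)`, to which the lower bound on `α² d K`
    -- applies.
    have h1 : 2 * X = Real.posLog (R ^ 2 / s) := by
      rw [← hratio, Real.posLog_pow, ← hX]; norm_num
    have h2 : Real.posLog (R ^ 2 / s) ≤ Real.posLog (R ^ 2 / q * K) := by
      apply Real.posLog_le_posLog (by positivity)
      rw [div_mul_eq_mul_div, div_le_div_iff₀ hs hq]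
      calc R ^ 2 * q ≤ R ^ 2 * (s * K) := by gcongr
        _ = _ := by ring
    have h3 := h2.trans Real.posLog_mul
    rw [Real.log_of_nat_eq_posLog.symm]
    linarith
  have hlogX : Real.log (X + 1) ≤ X := by
    have := Real.log_le_sub_one_of_pos (by linarith : 0 < X + 1); linarith
  have hlogm : Real.log m ≤ Real.log K := Real.log_le_log hm0 hmK'
  have e : logFactor P m
      = Real.log 32 + Real.log (X + 1) + 2 * Real.log m + Real.log (1 / P.δ) := by
    rw [logFactor, ← hX, div_eq_mul_one_div, Real.log_mul (by positivity) (by positivity),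
      Real.log_mul (by positivity) (by positivity), Real.log_mul (by norm_num) (by positivity),
      Real.log_pow]
    norm_num
  rw [e]
  linarith

/-- The sum of all the regret terms is of the order of the rate. -/
lemma regret_terms_le {d K n w α T L N J β BK VK A R lam C₁ C₂ c : ℝ} (hd : 0 < d) (hK : 0 < K)
    (hd1 : 1 ≤ d) (hn : 0 < n) (hw : 0 < w) (hα : 0 < α) (hT : 0 < T) (hL : 1 ≤ L) (hBK : 0 < BK)
    (hVK : 0 < VK) (hR : 0 < R) (hlam : 0 < lam) (hC₁ : 0 < C₁) (hC₂ : 0 < C₂) (hc : 1 ≤ c)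
    (hN0 : 0 ≤ N) (hJ0 : 0 ≤ J) (hN : N ≤ 3 * K / w) (hJ : J ≤ C₁ * d * L)
    (hβ : β ≤ C₂ * Real.sqrt d * L) (hnw : n ≤ c * w)
    (h1 : d * K / w ≤ T) (h2 : d * Real.sqrt (K * VK) / Real.sqrt w ≤ T)
    (h3 : d * K * α / Real.sqrt w ≤ T) (h4 : Real.sqrt w * w * BK / α ≤ T) :
    4 * N + 2 * (Real.sqrt n * A / α * (A / Real.sqrt lam)) * (n * BK) + 4 * (N * J)
      + 2 * β * (Real.sqrt (2 * (N * J)) * Real.sqrt (2 * VK + 2 * K * α ^ 2)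
        + 2 * (R / Real.sqrt d) * (N * J))
      ≤ (12 + 2 * A ^ 2 / Real.sqrt lam * c ^ 2 + 12 * C₁
        + 2 * C₂ * (4 * Real.sqrt (3 * C₁) + 6 * R * C₁)) * L ^ 2 * T := by
  have hL2 : L ≤ L ^ 2 := by nlinarith
  have hL1 : 1 ≤ L ^ 2 := hL.trans hL2
  have hsd : 0 < Real.sqrt d := Real.sqrt_pos.2 hd
  have hsw : 0 < Real.sqrt w := Real.sqrt_pos.2 hw
  have hsl : 0 < Real.sqrt lam := Real.sqrt_pos.2 hlam
  have hNJ : N * J ≤ 3 * C₁ * L * T := by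
    calc N * J ≤ 3 * K / w * (C₁ * d * L) := by gcongr
      _ = 3 * C₁ * L * (d * K / w) := by ring
      _ ≤ _ := by gcongr
  have t1 : 4 * N ≤ 12 * L ^ 2 * T := by
    have : N ≤ 3 * T := by
      calc N ≤ 3 * K / w := hN
        _ = 3 * (1 * K / w) := by ring
        _ ≤ 3 * (d * K / w) := by gcongr
        _ ≤ _ := by gcongr
    nlinarith [mul_le_mul_of_nonneg_right hL1 hT.le]
  have t2 : 2 * (Real.sqrt n * A / α * (A / Real.sqrt lam)) * (n * BK)
      ≤ 2 * A ^ 2 / Real.sqrt lam * c ^ 2 * L ^ 2 * T := by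
    have hsn : Real.sqrt n ≤ c * Real.sqrt w := by
      rw [Real.sqrt_le_left (by positivity), mul_pow, Real.sq_sqrt hw.le]
      calc n ≤ c * w := hnw
        _ ≤ c ^ 2 * w := by gcongr; nlinarith
    calc _ = 2 * A ^ 2 / Real.sqrt lam * (Real.sqrt n * n * BK / α) := by field_simp
      _ ≤ 2 * A ^ 2 / Real.sqrt lam * (c * Real.sqrt w * (c * w) * BK / α) := by gcongr
      _ = 2 * A ^ 2 / Real.sqrt lam * c ^ 2 * 1 * (Real.sqrt w * w * BK / α) := by ring
      _ ≤ _ := by gcongr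
  have t3 : 4 * (N * J) ≤ 12 * C₁ * L ^ 2 * T := by
    calc 4 * (N * J) ≤ 4 * (3 * C₁ * L * T) := by gcongr
      _ = 12 * C₁ * L * T := by ring
      _ ≤ _ := by gcongr
  have t5 : 2 * β * (2 * (R / Real.sqrt d) * (N * J)) ≤ 2 * C₂ * (6 * R * C₁) * L ^ 2 * T := by
    calc 2 * β * (2 * (R / Real.sqrt d) * (N * J))
        ≤ 2 * (C₂ * Real.sqrt d * L) * (2 * (R / Real.sqrt d) * (3 * C₁ * L * T)) := by gcongr
      _ = _ := by field_simp; ring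
  have t4 : 2 * β * (Real.sqrt (2 * (N * J)) * Real.sqrt (2 * VK + 2 * K * α ^ 2))
      ≤ 2 * C₂ * (4 * Real.sqrt (3 * C₁)) * L ^ 2 * T := by
    have s1 : Real.sqrt (2 * VK + 2 * K * α ^ 2)
        ≤ Real.sqrt 2 * (Real.sqrt VK + Real.sqrt K * α) := by
      rw [Real.sqrt_le_left (by positivity), mul_pow, Real.sq_sqrt (by norm_num : (0 : ℝ) ≤ 2),
        add_sq, mul_pow, Real.sq_sqrt hVK.le, Real.sq_sqrt hK.le]
      have : 0 ≤ 2 * Real.sqrt VK * (Real.sqrt K * α) := by positivity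
      linarith
    have s2 : Real.sqrt (2 * (N * J))
        ≤ Real.sqrt 2 * (Real.sqrt (3 * C₁) * Real.sqrt K * Real.sqrt d * L / Real.sqrt w) := by
      rw [Real.sqrt_le_left (by positivity), mul_pow, Real.sq_sqrt (by norm_num : (0 : ℝ) ≤ 2),
        div_pow, mul_pow, mul_pow, mul_pow, Real.sq_sqrt (by positivity), Real.sq_sqrt hK.le,
        Real.sq_sqrt hd.le, Real.sq_sqrt hw.le]
      have : N * J ≤ 3 * C₁ * K * d * L ^ 2 / w := by
        calc N * J ≤ 3 * K / w * (C₁ * d * L) := by gcongr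
          _ ≤ 3 * K / w * (C₁ * d * L ^ 2) := by gcongr
          _ = _ := by ring
      linarith
    have s3 : Real.sqrt (K * VK) = Real.sqrt K * Real.sqrt VK := Real.sqrt_mul hK.le _
    have q2 : Real.sqrt 2 * Real.sqrt 2 = 2 := Real.mul_self_sqrt (by norm_num)
    have qd : Real.sqrt d * Real.sqrt d = d := Real.mul_self_sqrt hd.le
    have qK : Real.sqrt K * Real.sqrt K = K := Real.mul_self_sqrt hK.le
    calc _ ≤ 2 * (C₂ * Real.sqrt d * L) * ((Real.sqrt 2 * (Real.sqrt (3 * C₁) * Real.sqrt K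
            * Real.sqrt d * L / Real.sqrt w)) * (Real.sqrt 2 * (Real.sqrt VK + Real.sqrt K * α))) :=
          by gcongr
      _ = 2 * C₂ * Real.sqrt (3 * C₁) * L ^ 2 * (Real.sqrt 2 * Real.sqrt 2)
          * ((Real.sqrt d * Real.sqrt d) * (Real.sqrt K * Real.sqrt VK) / Real.sqrt w
            + (Real.sqrt d * Real.sqrt d) * (Real.sqrt K * Real.sqrt K) * α / Real.sqrt w) := by
          field_simp
      _ ≤ 2 * C₂ * Real.sqrt (3 * C₁) * L ^ 2 * 2 * (T + T) := by
          rw [q2, qd, qK, ← s3]; gcongr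
      _ = _ := by ring
  calc _ = 4 * N + 2 * (Real.sqrt n * A / α * (A / Real.sqrt lam)) * (n * BK) + 4 * (N * J)
      + 2 * β * (Real.sqrt (2 * (N * J)) * Real.sqrt (2 * VK + 2 * K * α ^ 2))
      + 2 * β * (2 * (R / Real.sqrt d) * (N * J)) := by ring
    _ ≤ _ := by linarith

end Rates

/-! ### Radius and log-determinant for the tuned parameters -/

section Main

lemma logDet_update_le {d : ℕ} {P : Params} (hl : 0 < P.lam) (hα : 0 < P.α) (hd : 1 ≤ d)
    {a : ℕ → Vec d} {r σ : ℕ → ℝ} {A : ℝ} {K k : ℕ}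
    (ha : ∀ t ∈ Finset.Icc 1 K, ‖a t‖ ≤ A) (hk : k ∈ Finset.Icc 1 K) :
    ((stats P a r σ k).update P (a k) (r k) (σ k)).logDet P
      ≤ d * Real.log (1 + 2 * K * A ^ 2 / (P.α ^ 2 * d * P.lam)) := by
  have hk' := Finset.mem_Icc.1 hk
  have hd0 : (0 : ℝ) < d := by exact_mod_cast hd
  have h1 := trace_update_le hα (stats P a r σ k) (ha k hk) (r k) (σ k)
  have h2 := trace_stats_le hα r σ ha (by omega : k ≤ K + 1)
  have h3 : ((k % P.w : ℕ) : ℝ) + 1 ≤ 2 * K := by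
    have := Nat.mod_le k P.w
    exact_mod_cast (by omega : k % P.w + 1 ≤ 2 * K)
  have h4 : (((k % P.w : ℕ) : ℝ) + 1) * (A ^ 2 / P.α ^ 2) ≤ 2 * K * (A ^ 2 / P.α ^ 2) := by gcongr
  refine (((stats_regular hl a r σ k).update _ _ _).logDet_le hl hd
    (T := 2 * K * (A ^ 2 / P.α ^ 2)) (by linarith)).trans (le_of_eq ?_)
  congr 3
  field_simp

/-- The choice `γ² = R / √d` makes `R / γ² = √d`, so the Bernstein correction is no larger, up to
logarithms, than the leading `√d` term. -/
lemma radius_le {d K : ℕ} {P : Params} {q L Cι Cl : ℝ} (hd : 1 ≤ d) (hK : 1 ≤ K)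
    (hl : 0 < P.lam) (hB : 0 ≤ P.B) (hα : 0 < P.α) (hδ0 : 0 < P.δ) (hδ1 : P.δ < 1) (hq : 0 < q)
    (hqs : q ≤ P.α ^ 2 * d * K) (hγ : P.γ ^ 2 = P.R / Real.sqrt d) (hR : 0 < P.R)
    (hL : L = 1 + Real.log (d * K / P.δ))
    (hCι : Cι = Real.log (1 + 2 * P.A ^ 2 / (q * P.lam)) + 2)
    (hCl : Cl = Real.log 32 + Real.posLog (P.R ^ 2 / q) + 3)
    {k : ℕ} (hk : k ∈ Finset.Icc 1 K) (hr : ¬ P.IsRestart k) :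
    radius d P k ≤ (12 * Real.sqrt (Cι * Cl) + 30 * Cl + Real.sqrt P.lam * P.B)
      * Real.sqrt d * L := by
  have hd1 : (1 : ℝ) ≤ d := by exact_mod_cast hd
  have hK1 : (1 : ℝ) ≤ K := by exact_mod_cast hK
  have hd0 : (0 : ℝ) < d := by linarith
  have hk' := Finset.mem_Icc.1 hk
  have hm : 1 ≤ k % P.w := by
    by_contra h0
    exact hr (Or.inr (by omega))
  have hmK : k % P.w ≤ K := (Nat.mod_le _ _).trans hk'.2
  have hs : 0 < P.α ^ 2 * d := by positivity
  have hLe : L = 1 + Real.log d + Real.log K + Real.log (1 / P.δ) := by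
    rw [hL, div_eq_mul_one_div, Real.log_mul (by positivity) (by positivity),
      Real.log_mul (by positivity) (by positivity)]
    ring
  have hlogd := Real.log_nonneg hd1
  have hlogK := Real.log_nonneg hK1
  have hlogδ : 0 ≤ Real.log (1 / P.δ) := Real.log_nonneg (by
    rw [le_div_iff₀ hδ0]; linarith)
  have hL1 : 1 ≤ L := by linarith
  have hlog1 : 0 ≤ Real.log (1 + 2 * P.A ^ 2 / (q * P.lam)) := Real.log_nonneg (by
    have : 0 ≤ 2 * P.A ^ 2 / (q * P.lam) := by positivity
    linarith)
  have hlog32 : 0 ≤ Real.log 32 := Real.log_nonneg (by norm_num)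
  have hpos := Real.posLog_nonneg (x := P.R ^ 2 / q)
  have hCι0 : 0 ≤ Cι := by linarith
  have hCl0 : 0 ≤ Cl := by linarith
  have hι : Real.log (1 + ((k % P.w : ℕ) : ℝ) * P.A ^ 2 / (P.α ^ 2 * d * P.lam)) ≤ Cι * L := by
    refine (log_one_add_div_le (A := P.A) hK1 hq hl hs hqs (Nat.cast_nonneg (k % P.w)) ?_).trans ?_
    · have : ((k % P.w : ℕ) : ℝ) ≤ K := by exact_mod_cast hmK
      linarith
    · rw [hCι]; nlinarith
  have hratio : (P.γ ^ 2 / P.α) ^ 2 = P.R ^ 2 / (P.α ^ 2 * d) := by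
    rw [hγ, div_pow, div_pow, Real.sq_sqrt hd0.le]; field_simp
  have hℓ : logFactor P (k % P.w) ≤ Cl * L := by
    refine (logFactor_le hδ0 hq hK hs hqs hratio hm hmK).trans ?_
    rw [hCl]
    nlinarith
  have hℓ0 : 0 ≤ logFactor P (k % P.w) := zero_le_one.trans (one_le_logFactor hδ0 hδ1 hm)
  have hRg : P.R / P.γ ^ 2 = Real.sqrt d := by rw [hγ]; field_simp
  have hsd1 : 1 ≤ Real.sqrt d := Real.one_le_sqrt.2 hd1
  have hroot : Real.sqrt (d * Real.log (1 + ((k % P.w : ℕ) : ℝ) * P.A ^ 2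
      / (P.α ^ 2 * d * P.lam)) * logFactor P (k % P.w))
      ≤ Real.sqrt (Cι * Cl) * Real.sqrt d * L := by
    rw [Real.sqrt_le_left (by positivity), mul_pow, mul_pow, Real.sq_sqrt (by positivity),
      Real.sq_sqrt hd0.le]
    calc _ ≤ d * (Cι * L) * (Cl * L) := by gcongr
      _ = _ := by ring
  have hlast : Real.sqrt P.lam * P.B ≤ Real.sqrt P.lam * P.B * Real.sqrt d * L := by
    have h0 : 0 ≤ Real.sqrt P.lam * P.B := by positivity
    calc Real.sqrt P.lam * P.B = Real.sqrt P.lam * P.B * 1 * 1 := by ring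
      _ ≤ _ := by gcongr
  rw [radius, if_neg (show ¬ (k = 1 ∨ k % P.w = 0) from hr), hRg]
  calc _ ≤ 12 * (Real.sqrt (Cι * Cl) * Real.sqrt d * L) + 30 * (Cl * L) * Real.sqrt d
        + Real.sqrt P.lam * P.B * Real.sqrt d * L := by gcongr
    _ = _ := by ring

lemma regret_le_two_mul {d K : ℕ} {θ aStar a : ℕ → Vec d} {D : ℕ → Set (Vec d)}
    (hmean : ∀ k ∈ Finset.Icc 1 K, ∀ x ∈ D k, inner ℝ x (θ k) ∈ Set.Icc (-1 : ℝ) 1)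
    (ha : ∀ k ∈ Finset.Icc 1 K, a k ∈ D k) (hstar : ∀ k ∈ Finset.Icc 1 K, aStar k ∈ D k) :
    regret K θ aStar a ≤ 2 * K := by
  have h := Finset.sum_le_card_nsmul (Finset.Icc 1 K)
    (fun k => inner ℝ (aStar k) (θ k) - inner ℝ (a k) (θ k)) 2 fun k hk => by
      have h1 := (hmean k hk _ (hstar k hk)).2
      have h2 := (hmean k hk _ (ha k hk)).1
      linarith
  rw [Nat.card_Icc, Nat.add_sub_cancel, nsmul_eq_mul] at h
  exact h.trans (le_of_eq (mul_comm _ _))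

end Main

end NonstatBandit

end

/-! ### Assembly of the main theorem -/

open NonstatBandit in
theorem mainTheorem2 :
    ∃ p : ℕ, ∀ A B R lam c₁ c₂ : ℝ, 0 < A → 0 < B → 0 < R → 0 < lam → 0 < c₁ → 0 < c₂ →
      ∃ C : ℝ, 0 < C ∧
        ∀ (d K n : ℕ) (δ BK VK : ℝ), 1 ≤ d → 1 ≤ K → 0 < δ → δ < 1 →
          BK ∈ Set.Icc c₁ (c₂ * K) → VK ∈ Set.Icc c₁ (c₂ * K) →
          -- the restart window size `n ≥ 1` is the real number `w`, rounded down or up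
          1 ≤ n → |(n : ℝ) - NonstatBandit.targetWindow d K BK VK| < 1 →
          ∀ {Ω : Type*} [MeasurableSpace Ω] (μ : Measure Ω) [IsProbabilityMeasure μ]
            (D : ℕ → Ω → Set (NonstatBandit.Vec d)) (θ : ℕ → NonstatBandit.Vec d)
            (a aStar : ℕ → Ω → NonstatBandit.Vec d) (ε σ : ℕ → Ω → ℝ),
            NonstatBandit.IsBandit μ K A B R BK VK D θ a ε σ →
            (∀ ω, NonstatBandit.IsRun (NonstatBandit.tunedParams d K n A B R lam δ BK VK) K
              (fun k => D k ω) (fun k => a k ω)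
              (NonstatBandit.reward θ (fun k => a k ω) (fun k => ε k ω)) (fun k => σ k ω)) →
            (∀ k ∈ Finset.Icc 1 K, ∀ ω, aStar k ω ∈ D k ω ∧
              IsMaxOn (fun x => inner ℝ x (θ k)) (D k ω) (aStar k ω)) →
            μ {ω | C * (1 + Real.log (d * K / δ)) ^ p *
                  ((d : ℝ) ^ (7 / 8 : ℝ) * (BK * VK) ^ (1 / 4 : ℝ) * Real.sqrt K
                    + (d : ℝ) ^ (5 / 6 : ℝ) * BK ^ (1 / 3 : ℝ) * (K : ℝ) ^ (2 / 3 : ℝ))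
                < NonstatBandit.regret K θ (fun k => aStar k ω) (fun k => a k ω)}
              ≤ ENNReal.ofReal δ := by
  classical
  refine ⟨2, fun A B R lam c₁ c₂ hA hB hR hlam hc₁ hc₂ => ?_⟩
  set c₃ : ℝ := min 1 c₂⁻¹ with hc₃
  have hc₃0 : 0 < c₃ := lt_min one_pos (inv_pos.2 hc₂)
  set q : ℝ := c₁ * c₃ ^ 2 with hq
  have hq0 : 0 < q := by positivity
  set Cι : ℝ := Real.log (1 + 2 * A ^ 2 / (q * lam)) + 2 with hCι
  set Cl : ℝ := Real.log 32 + Real.posLog (R ^ 2 / q) + 3 with hCl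
  set Cβ : ℝ := 12 * Real.sqrt (Cι * Cl) + 30 * Cl + Real.sqrt lam * B with hCβ
  set c₄ : ℝ := 1 + 1 / c₃ with hc₄
  set c₅ : ℝ := min 1 (min c₁ (c₁ ^ 2 / c₂)) with hc₅
  have hc₅0 : 0 < c₅ := lt_min one_pos (lt_min hc₁ (by positivity))
  have hlog1 : 0 ≤ Real.log (1 + 2 * A ^ 2 / (q * lam)) := Real.log_nonneg (by
    have : 0 ≤ 2 * A ^ 2 / (q * lam) := by positivity
    linarith)
  have hCι0 : 0 < Cι := by linarith
  have hCl0 : 0 < Cl := by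
    have := Real.posLog_nonneg (x := R ^ 2 / q)
    have : 0 ≤ Real.log 32 := Real.log_nonneg (by norm_num)
    linarith
  have hCβ0 : 0 < Cβ := by positivity
  have hc₄1 : 1 ≤ c₄ := by
    have : 0 < 1 / c₃ := by positivity
    linarith
  set C₀ : ℝ := 12 + 2 * A ^ 2 / Real.sqrt lam * c₄ ^ 2 + 12 * Cι
        + 2 * Cβ * (4 * Real.sqrt (3 * Cι) + 6 * R * Cι) with hC₀
  have hC₀0 : 0 < C₀ := by positivity
  -- `C₀` serves the case `w ≤ K`; `2 / c₅` absorbs the trivial regret `2K` when `K < w`.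
  refine ⟨C₀ + 2 / c₅, by positivity, ?_⟩
  intro d K n δ BK VK hd hK hδ0 hδ1 hBK hVK hn hnw Ω _ μ _ D θ a aStar ε σ hb hrun hstar
  set P := tunedParams d K n A B R lam δ BK VK with hP
  set w := targetWindow d K BK VK with hw
  set L := 1 + Real.log (d * K / δ) with hL
  obtain ⟨hwc, hα0, hT0, hqα, hr1, hr2, hr3, hr4, hr5⟩ :=
    tuned_rates (n := n) (A := A) (B := B) (R := R) (lam := lam) (δ := δ) hd hK hc₁ hc₂ hBK hVK
      hw rfl rfl
  rw [← hP] at hα0 hqα hr3 hr4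
  change μ {ω | (C₀ + 2 / c₅) * L ^ 2 * rate d K BK VK < _} ≤ _
  set T := rate d K BK VK with hT
  have hd1 : (1 : ℝ) ≤ d := by exact_mod_cast hd
  have hK1 : (1 : ℝ) ≤ K := by exact_mod_cast hK
  have hn1 : (1 : ℝ) ≤ n := by exact_mod_cast hn
  have hd0 : (0 : ℝ) < d := by linarith
  have hK0 : (0 : ℝ) < K := by linarith
  have hw0 : 0 < w := hc₃0.trans_le hwc
  have hL1 : 1 ≤ L := by
    have : 0 ≤ Real.log (d * K / δ) := Real.log_nonneg (by
      rw [le_div_iff₀ hδ0, one_mul]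
      exact hδ1.le.trans (one_le_mul_of_one_le_of_one_le hd1 hK1))
    linarith
  have hLsq : 1 ≤ L ^ 2 := one_le_pow₀ hL1
  have haD : ∀ ω, ∀ k ∈ Finset.Icc 1 K, a k ω ∈ D k ω := fun ω k hk => (hrun ω k hk).1
  have haA : ∀ k ∈ Finset.Icc 1 K, ∀ ω, ‖a k ω‖ ≤ A := fun k hk ω =>
    hb.norm_arm_le k hk ω _ (haD ω k hk)
  rcases lt_or_ge (K : ℝ) w with hKw | hKw
  · have hempty : {ω | (C₀ + 2 / c₅) * L ^ 2 * T
        < regret K θ (fun k => aStar k ω) (fun k => a k ω)} = ∅ := by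
      refine Set.eq_empty_of_forall_notMem fun ω hω => ?_
      have h1 := regret_le_two_mul (D := fun k => D k ω) (fun k hk => hb.mean_reward_mem k hk ω)
        (haD ω) (fun k hk => (hstar k hk ω).1)
      have h2 : 2 * (K : ℝ) ≤ (C₀ + 2 / c₅) * L ^ 2 * T := by
        calc 2 * (K : ℝ) = 2 / c₅ * 1 * (c₅ * K) := by field_simp
          _ ≤ (C₀ + 2 / c₅) * L ^ 2 * T := by
            gcongr
            · linarith
            · exact hr5 hKw
      exact absurd hω (not_lt.2 (h1.trans h2))
    rw [hempty, measure_empty]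
    exact zero_le
  have hγ2 : P.γ ^ 2 = R / Real.sqrt d := Real.sq_sqrt (by positivity)
  have hγ0 : 0 < P.γ := Real.sqrt_pos.2 (by positivity)
  have hqs : q ≤ P.α ^ 2 * d * K := le_trans (by rw [hq]; gcongr) hqα
  have hcount := hb.measureReal_card_isBad_gt_le (P := P) rfl rfl hR hA hd hn hlam hα0 hγ0 hδ0 hδ1
    haA
  rw [← ofReal_measureReal]
  apply ENNReal.ofReal_le_ofReal
  -- The regret event need not be measurable; almost surely it is contained in the event of too many
  -- bad rounds, and monotonicity of the outer measure suffices.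
  refine le_trans (ENNReal.toReal_mono (measure_ne_top _ _) (measure_mono_ae ?_)) hcount
  have hsd : ∀ᵐ ω ∂μ, ∀ k ∈ Finset.Icc 1 K, σ k ω = condSd μ a ε k ω :=
    (Filter.eventually_all_finset _).2 fun k hk => hb.sd_ae_eq hk
  filter_upwards [hsd, hb.total_variance] with ω hσω hVω hω
  by_contra hcon
  have hcard : (((Finset.Icc 1 K).filter (IsBad d P (fun t => a t ω) (fun t => ε t ω)
      (fun t => σ t ω))).card : ℝ) ≤ (K / P.w : ℕ) + 1 := by
    have he : (Finset.Icc 1 K).filter (IsBad d P (fun t => a t ω) (fun t => ε t ω)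
        (fun t => σ t ω)) = (Finset.Icc 1 K).filter (IsBad d P (fun t => a t ω) (fun t => ε t ω)
        (fun t => condSd μ a ε t ω)) := by
      refine Finset.filter_congr fun k hk => ?_
      rw [Finset.mem_Icc] at hk
      rw [IsBad, IsBad, stats_congr_sd P (fun t => a t ω) (fun t => ε t ω) fun t ht =>
        hσω t (by rw [Finset.mem_Ico] at ht; exact Finset.mem_Icc.2 ⟨ht.1, by omega⟩)]
    rw [he]
    exact not_lt.1 hcon
  set J : ℝ := d * Real.log (1 + 2 * K * A ^ 2 / (P.α ^ 2 * d * lam)) with hJ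
  have hJ0 : 0 ≤ J := by
    refine mul_nonneg hd0.le (Real.log_nonneg ?_)
    have : 0 ≤ 2 * K * A ^ 2 / (P.α ^ 2 * d * lam) := by positivity
    linarith
  have hJL : J ≤ Cι * d * L := by
    have h1 := log_one_add_div_le (A := A) hK1 hq0 hlam (by positivity : 0 < P.α ^ 2 * d) hqs
      (by positivity : (0 : ℝ) ≤ 2 * K) le_rfl
    have h2 : Real.log K ≤ L := by
      have : Real.log K ≤ Real.log (d * K / δ) := Real.log_le_log hK0 (by
        rw [le_div_iff₀ hδ0]
        exact (mul_le_of_le_one_right hK0.le hδ1.le).trans (le_mul_of_one_le_left hK0.le hd1))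
      linarith
    have h3 : Real.log (1 + 2 * K * A ^ 2 / (P.α ^ 2 * d * lam)) ≤ Cι * L := by
      refine h1.trans ?_
      rw [hCι, add_mul]
      linarith [le_mul_of_one_le_right hlog1 hL1]
    calc J ≤ d * (Cι * L) := by rw [hJ]; gcongr
      _ = _ := by ring
  have hbound := regret_le_of_card_isBad (P := P) hlam hα0 hγ0 hn hK (J := J)
    (β := Cβ * Real.sqrt d * L) (N := (K / P.w : ℕ) + 1) hA.le (D := fun k => D k ω)
    (fun k hk => hb.norm_arm_le k hk ω) (fun k hk => hb.mean_reward_mem k hk ω)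
    hb.norm_feature_le (fun k hk => hb.sd_nonneg k hk ω) hb.total_variation hVω (hrun ω)
    (fun k hk => (hstar k hk ω).1) (by positivity)
    (fun k hk hr => radius_le (P := P) hd hK hlam hB.le hα0 hδ0 hδ1 hq0 hqs hγ2 hR hL hCι hCl hk
      hr)
    hJ0 (fun k hk => logDet_update_le hlam hα0 hd (fun t ht => haA t ht ω) hk) le_rfl hcard
  have hnw' := abs_lt.1 hnw
  -- From `n ≥ 1` and `w < n + 1` follows `w ≤ 2n`, which handles the quotient; absorbing the
  -- additional one uses `w ≤ K`.
  have hN : ((K / n : ℕ) + 1 : ℝ) ≤ 3 * K / w := by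
    have h1 : ((K / n : ℕ) : ℝ) ≤ K / n := Nat.cast_div_le
    have h2 : (K : ℝ) / n ≤ 2 * K / w := by
      rw [div_le_div_iff₀ (by linarith) hw0, mul_comm 2 (K : ℝ), mul_assoc]
      exact mul_le_mul_of_nonneg_left (by linarith) hK0.le
    have h3 : 1 ≤ K / w := by rw [le_div_iff₀ hw0]; linarith
    calc ((K / n : ℕ) + 1 : ℝ) ≤ 2 * K / w + K / w := by linarith
      _ = _ := by ring
  have hnc : (n : ℝ) ≤ c₄ * w := by
    have h1 : 1 ≤ 1 / c₃ * w := by rw [one_div_mul_eq_div, le_div_iff₀ hc₃0]; linarith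
    rw [hc₄, add_mul]; linarith
  have hfinal := regret_terms_le (d := d) (K := K) (n := n) (w := w) (α := P.α) (T := T) (L := L)
    (N := (K / n : ℕ) + 1) (J := J) (β := Cβ * Real.sqrt d * L) (BK := BK) (VK := VK) (A := A)
    (R := R) (lam := lam) (C₁ := Cι) (C₂ := Cβ) (c := c₄) hd0 hK0 hd1 (by linarith) hw0 hα0 hT0
    hL1 (hc₁.trans_le hBK.1) (hc₁.trans_le hVK.1) hR hlam hCι0 hCβ0 hc₄1 (by positivity) hJ0 hN
    hJL le_rfl hnc hr1 hr2 hr3 hr4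
  rw [hγ2] at hbound
  have hle : regret K θ (fun k => aStar k ω) (fun k => a k ω) ≤ C₀ * L ^ 2 * T :=
    hbound.trans hfinal
  have hlt : (C₀ + 2 / c₅) * L ^ 2 * T < regret K θ (fun k => aStar k ω) (fun k => a k ω) := hω
  have h0 : 0 < 2 / c₅ * L ^ 2 * T := by positivity
  linarith [add_mul C₀ (2 / c₅) (L ^ 2), add_mul (C₀ * L ^ 2) (2 / c₅ * L ^ 2) T]
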